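/- Theorem 8.2. The doublet is the graph with vertices $v_1,\dots,v_6$ and the nine edges $v_1v_2,\ v_2v_3,\ v_3v_4,\ v_4v_5,\ v_5v_6,\ v_6v_3,\ v_2v_6,\ v_1v_5,\ v_1v_4$; give these edges, in this order, the lengths $d_1,\dots,d_9$, where $d_1=1$. Its constraint variety is the set of all $((x_i,y_i))_{1\le i\le 6}\in(\mathbb{C}^2)^6$ with $(x_1,y_1)=(0,0)$, $(x_2,y_2)=(1,0)$ and $(x_i-x_j)^2+(y_i-y_j)^2=d_k^2$ whenever $v_iv_j$ is the edge of length $d_k$. For integral lengths, the dimensioned doublet is soluble by radicals if every coordinate of every point of its constraint variety lies in a radical extension of $\mathbb{Q}$. (a) The integral dimensioned doublet with $(d_1,\dots,d_9)=(1,5,15,10,16,8,5,13,13)$ is not soluble by radicals. (b) Number the vertices of this dimensioned doublet anew by exchanging $v_1$ with $v_2$, $v_3$ with $v_4$ and $v_5$ with $v_6$, so that $(d_1,\dots,d_9)=(1,13,15,8,16,10,13,5,5)$. Put $s_3=d_2^2-(x_3-1)^2$, $s_4=d_9^2-x_4^2$, $s_5=d_8^2-x_5^2$, $s_6=d_7^2-(x_6-1)^2$,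 and for $(k,i,j)=(3,3,4),(4,4,5),(5,5,6),(6,6,3)$ let $$g_{k-2}=\bigl(d_k^2-(x_i-x_j)^2-s_i-s_j\bigr)^2-4s_is_j .$$ Let $h_1'=\mathrm{Res}(g_1,g_2,x_4)$, $h_2'=\mathrm{Res}(g_3,g_4,x_6)$ and $h_3'=\mathrm{Res}(h_1',h_2',x_5)\in\mathbb{Q}[x_3]$. Then the eliminant $h_3'(x_3)$ has degree $28$ and is a product of four irreducible polynomials over $\mathbb{Q}$ of degrees $6,6,8,8$, and the Galois group of each factor over $\mathbb{Q}$ is the full symmetric group on its complex roots. -/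

import Mathlib

/-- The complex variety of the normalised constraint equations of the graph `G` with edge lengths
`len`: placements `p` of the vertices in `ℂ²` that put the ends of the base edge `(a, b)` at `(0, 0)`
and `(1, 0)` and satisfy `(x_v - x_w)² + (y_v - y_w)² = len(vw)²` for every edge `vw`. -/
def constraintVariety {V : Type*} (G : SimpleGraph V) (a b : V) (len : Sym2 V → ℕ) :
    Set (V → ℂ × ℂ) :=
  {p | p a = (0, 0) ∧ p b = (1, 0) ∧
    ∀ v w, G.Adj v w →
      ((p v).1 - (p w).1) ^ 2 + ((p v).2 - (p w).2) ^ 2 = (len s(v, w) : ℂ) ^ 2}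

/-- The dimensioned graph with integral edge lengths `len` is soluble by radicals: every coordinate
of every point of its constraint variety lies in a radical extension of the field generated by the
dimensions, which is `ℚ` since the dimensions are integers. -/
def IsSolubleByRadicals {V : Type*} (G : SimpleGraph V) (a b : V) (len : Sym2 V → ℕ) : Prop :=
  ∀ p ∈ constraintVariety G a b len, ∀ v,
    (p v).1 ∈ solvableByRad ℚ ℂ ∧ (p v).2 ∈ solvableByRad ℚ ℂ

/-- The doublet: two triangles joined by three disjoint edges. The vertex `v_i` is `i - 1 : Fin 6`,
so the triangles are `v₁ v₄ v₅` and `v₂ v₃ v₆`. -/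
def doublet : SimpleGraph (Fin 6) :=
  SimpleGraph.fromEdgeSet
    {s(0, 1), s(1, 2), s(2, 3), s(3, 4), s(4, 5), s(5, 2), s(1, 5), s(0, 4), s(0, 3)}

/-- The lengths `d = (d₁, …, d₉)` as a function on the edges of the doublet, which are taken in the
order `v₁v₂, v₂v₃, v₃v₄, v₄v₅, v₅v₆, v₆v₃, v₂v₆, v₁v₅, v₁v₄`. The value `0` off the edges is never
used. -/
def doubletLength (d : Fin 9 → ℕ) (e : Sym2 (Fin 6)) : ℕ :=
  if e = s(0, 1) then d 0 else
  if e = s(1, 2) then d 1 else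
  if e = s(2, 3) then d 2 else
  if e = s(3, 4) then d 3 else
  if e = s(4, 5) then d 4 else
  if e = s(5, 2) then d 5 else
  if e = s(1, 5) then d 6 else
  if e = s(0, 4) then d 7 else
  if e = s(0, 3) then d 8 else 0

/-- The renumbering of the vertices that exchanges `v₁` with `v₂`, `v₃` with `v₄` and `v₅` with
`v₆`. -/
def doubletSwap : Equiv.Perm (Fin 6) :=
  Equiv.swap 0 1 * Equiv.swap 2 3 * Equiv.swap 4 5

/-- The renumbering is an automorphism of the doublet. -/
theorem doublet_adj_swap (v w : Fin 6) :
    doublet.Adj (doubletSwap v) (doubletSwap w) ↔ doublet.Adj v w := by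
  simp only [doublet, SimpleGraph.fromEdgeSet_adj, Set.mem_insert_iff, Set.mem_singleton_iff]
  revert v w
  decide

/-- The two lists of lengths below describe the same dimensioned doublet, up to that renumbering. -/
theorem doubletLength_swap (e : Sym2 (Fin 6)) :
    doubletLength ![1, 13, 15, 8, 16, 10, 13, 5, 5] e =
      doubletLength ![1, 5, 15, 10, 16, 8, 5, 13, 13] (e.map doubletSwap) := by
  revert e
  decide

/-- The constraint `(a - a')² + (y - y')² = d²`, cleared of the odd powers of `y` and `y'` by
squaring; the arguments `s` and `s'` stand for `y²` and `y'²`. -/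
def squaredConstraint {R : Type*} [CommRing R] (d a a' s s' : R) : R :=
  (d ^ 2 - ((a - a') ^ 2 + s + s')) ^ 2 - 4 * s * s'

open Polynomial in
/-- The eliminant `h₃` of the doublet with respect to `x₃`, with base edge from `v₁ = (0, 0)` to
`v₂ = (1, 0)`. The four constraints on edges that avoid the base are squared, with
`y₃² = d₂² - (x₃ - 1)²`, `y₄² = d₉² - x₄²`, `y₅² = d₈² - x₅²`, `y₆² = d₇² - (x₆ - 1)²` substituted;
then `x₄`, `x₆`, `x₅` are eliminated in turn by resultants. Here `ℚ[X]` is `ℚ[x₃]`, `ℚ[X][X]` is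
`ℚ[x₃][x₅]`, and `ℚ[X][X][X]` is `ℚ[x₃][x₅][x₄]` for `g₁, g₂` and `ℚ[x₃][x₅][x₆]` for `g₃, g₄`. -/
noncomputable def doubletEliminant (len : Sym2 (Fin 6) → ℕ) : ℚ[X] :=
  let x₃ : ℚ[X][X][X] := C (C X)
  let x₅ : ℚ[X][X][X] := C X
  let x₄ : ℚ[X][X][X] := X
  let x₆ : ℚ[X][X][X] := X
  let s₃ : ℚ[X][X][X] := (len s(1, 2) : ℚ[X][X][X]) ^ 2 - (x₃ - 1) ^ 2
  let s₄ : ℚ[X][X][X] := (len s(0, 3) : ℚ[X][X][X]) ^ 2 - x₄ ^ 2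
  let s₅ : ℚ[X][X][X] := (len s(0, 4) : ℚ[X][X][X]) ^ 2 - x₅ ^ 2
  let s₆ : ℚ[X][X][X] := (len s(1, 5) : ℚ[X][X][X]) ^ 2 - (x₆ - 1) ^ 2
  let g₁ := squaredConstraint (len s(2, 3) : ℚ[X][X][X]) x₃ x₄ s₃ s₄
  let g₂ := squaredConstraint (len s(3, 4) : ℚ[X][X][X]) x₄ x₅ s₄ s₅
  let g₃ := squaredConstraint (len s(4, 5) : ℚ[X][X][X]) x₅ x₆ s₅ s₆
  let g₄ := squaredConstraint (len s(5, 2) : ℚ[X][X][X]) x₆ x₃ s₆ s₃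
  let h₁ : ℚ[X][X] := resultant g₁ g₂
  let h₂ : ℚ[X][X] := resultant g₃ g₄
  resultant h₁ h₂

/-- The Galois group of the splitting field of `p` over `ℚ` is the full symmetric group on the
complex roots of `p`. -/
def HasFullSymmetricGaloisGroup (p : Polynomial ℚ) : Prop :=
  haveI : Fact ((p.map (algebraMap ℚ ℂ)).Splits) := ⟨IsAlgClosed.splits _⟩
  Function.Bijective (Polynomial.Gal.galActionHom p ℂ)

/-! Both parts rest on four explicit integral polynomials, two sextics and two octics, whose product
is the eliminant.

Their Galois groups are found by Dedekind's method. Modulo a prime where such a polynomial keeps its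
degree and stays separable, the Frobenius map on the roots is the action of a Galois element
(`Polynomial.exists_frobenius`). For degree n, one prime has factors of degrees 1 and n - 1; here n
- 1 is 5 or 7, a prime, and the Galois element is a cycle fixing one root. At a second prime an odd
power of the Frobenius is a transposition. A third prime excludes rational roots. The cycle and the
lack of a rational root give irreducibility, hence transitivity, and a transitive group with such a
cycle and a transposition is the full symmetric group (`Subgroup.eq_top_of_isSwap_of_prime_cycle`).

For insolubility, every complex root x of `sexticTwo` occurs in a placement whose other coordinates
are rational polynomials in x. If x were a radical expression, the symmetric group of degree 6 would
be solvable.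

Numerical work is done on lists of integers in the kernel and transported by evaluation: at X for
polynomial identities, at reduced roots for congruences. -/

open Polynomial NumberField

/-! ### Arithmetic of integer coefficient lists, also modulo a prime and a polynomial -/

namespace IntList

variable {R S : Type*} [CommRing R] [CommRing S]

/-- The value at `x` of the polynomial whose list of coefficients, constant term first, is given. -/
def eval (x : R) : List ℤ → R
  | [] => 0
  | a :: l => a + x * eval x l

def add : List ℤ → List ℤ → List ℤ
  | [], m => m
  | l, [] => l
  | a :: l, b :: m => (a + b) :: add l m

def smul (c : ℤ) (l : List ℤ) : List ℤ := l.map (c * ·)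

def mul : List ℤ → List ℤ → List ℤ
  | [], _ => []
  | a :: l, m => add (smul a m) (0 :: mul l m)

def sub (l m : List ℤ) : List ℤ := add l (smul (-1) m)

def derivative : List ℤ → List ℤ
  | [] => []
  | _ :: l => add l (0 :: derivative l)

/-- Remove the zeros at the end of the list. -/
def trim : List ℤ → List ℤ
  | [] => []
  | a :: l => match trim l with
    | [] => if a = 0 then [] else [a]
    | b :: m => a :: b :: m

/-- The list of residues modulo `n`, without zeros at the end. -/
def mod (n : ℤ) (l : List ℤ) : List ℤ := trim (l.map (· % n))

@[simp] theorem eval_nil (x : R) : eval x [] = 0 := rfl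

@[simp] theorem eval_cons (x : R) (a : ℤ) (l : List ℤ) : eval x (a :: l) = a + x * eval x l := rfl

theorem map_eval (φ : R →+* S) (x : R) (l : List ℤ) : φ (eval x l) = eval (φ x) l := by
  induction l with
  | nil => simp
  | cons a l ih => simp [ih]

@[simp] theorem eval_add (x : R) (l m : List ℤ) : eval x (add l m) = eval x l + eval x m := by
  induction l generalizing m with
  | nil => simp [add]
  | cons a l ih =>
    cases m with
    | nil => simp [add]
    | cons b m => simp only [add, eval_cons, ih]; push_cast; ring

@[simp] theorem eval_smul (x : R) (c : ℤ) (l : List ℤ) : eval x (smul c l) = c * eval x l := by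
  induction l with
  | nil => simp [smul]
  | cons a l ih =>
    rw [smul] at ih
    simp only [smul, List.map_cons, eval_cons, ih]
    push_cast
    ring

@[simp] theorem eval_mul (x : R) (l m : List ℤ) : eval x (mul l m) = eval x l * eval x m := by
  induction l with
  | nil => simp [mul]
  | cons a l ih =>
    simp only [mul, eval_add, eval_smul, eval_cons, ih]
    push_cast
    ring

@[simp] theorem eval_sub (x : R) (l m : List ℤ) : eval x (sub l m) = eval x l - eval x m := by
  simp [sub, sub_eq_add_neg]

theorem derivative_eval_X (l : List ℤ) :
    Polynomial.derivative (eval (X : R[X]) l) = eval (X : R[X]) (derivative l) := by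
  induction l with
  | nil => simp [derivative]
  | cons a l ih => simp [derivative, ih]

@[simp] theorem eval_trim (x : R) (l : List ℤ) : eval x (trim l) = eval x l := by
  induction l with
  | nil => simp [trim]
  | cons a l ih =>
    rw [trim]
    split
    · rename_i h
      rw [h] at ih
      split_ifs with ha <;> simp [← ih, ha]
    · rename_i h
      rw [h] at ih
      simp [← ih]

theorem intCast_mod (n : ℕ) [CharP R n] (a : ℤ) : ((a % (n : ℤ) : ℤ) : R) = a := by
  conv_rhs => rw [← Int.emod_add_mul_ediv a n]
  simp

@[simp] theorem eval_mod (n : ℕ) [CharP R n] (x : R) (l : List ℤ) :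
    eval x (mod n l) = eval x l := by
  rw [mod, eval_trim]
  induction l with
  | nil => simp
  | cons a l ih => simp [ih, intCast_mod]

theorem eval_eq_of_mod_eq {n : ℕ} [CharP R n] (x : R) {l m : List ℤ} (h : mod n l = mod n m) :
    eval x l = eval x m := by
  rw [← eval_mod n, h, eval_mod]

/-- The product of `X` and `l` modulo `n` and the monic polynomial `m`. -/
def mulXMod (n : ℕ) (m l : List ℤ) : List ℤ :=
  mod n (add (0 :: l) (smul (-((0 :: l).getD (m.length - 1) 0)) m))

/-- The product of two polynomials modulo `n` and the monic polynomial `m`. -/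
def mulMod (n : ℕ) (m : List ℤ) : List ℤ → List ℤ → List ℤ
  | [], _ => []
  | a :: l, k => mod n (add (smul a k) (mulXMod n m (mulMod n m l k)))

def powMod (n : ℕ) (m l : List ℤ) : ℕ → List ℤ
  | 0 => [1]
  | k + 1 => mulMod n m (powMod n m l k) l

/-- The polynomial `X ^ n ^ k` modulo `n` and the monic polynomial `m`. -/
def frobMod (n : ℕ) (m : List ℤ) : ℕ → List ℤ
  | 0 => [0, 1]
  | k + 1 => powMod n m (frobMod n m k) n

section

variable {n : ℕ} [CharP R n] {x : R} {m : List ℤ}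

/-- Reduction only subtracts multiples of `m`, which vanish at `x`. So neither monicity of `m` nor
completeness of the reduction matters for correctness. -/
theorem eval_mulMod (hx : eval x m = 0) (l k : List ℤ) :
    eval x (mulMod n m l k) = eval x l * eval x k := by
  induction l with
  | nil => simp [mulMod]
  | cons a l ih =>
    simp only [mulMod, mulXMod, eval_mod, eval_add, eval_smul, eval_cons, hx, ih]
    push_cast
    ring

theorem eval_powMod (hx : eval x m = 0) (l : List ℤ) (k : ℕ) :
    eval x (powMod n m l k) = eval x l ^ k := by
  induction k with
  | zero => simp [powMod]
  | succ k ih => rw [powMod, eval_mulMod hx, ih, pow_succ]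

theorem eval_frobMod (hx : eval x m = 0) (k : ℕ) : eval x (frobMod n m k) = x ^ n ^ k := by
  induction k with
  | zero => simp [frobMod]
  | succ k ih => rw [frobMod, eval_powMod hx, ih, ← pow_mul, ← pow_succ]

end

theorem eval_append_one (x : R) (l : List ℤ) : eval x (l ++ [1]) = eval x l + x ^ l.length := by
  induction l with
  | nil => simp
  | cons a l ih => simp only [List.cons_append, eval_cons, ih, List.length_cons]; ring

theorem degree_eval_X_lt (l : List ℤ) : (eval (X : R[X]) l).degree < l.length := by
  induction l with
  | nil => simp
  | cons a l ih =>
    rw [eval_cons, List.length_cons]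
    nontriviality R
    refine (degree_add_le _ _).trans_lt (max_lt ?_ ?_)
    · rw [← Polynomial.C_eq_intCast]
      exact degree_C_le.trans_lt (by exact_mod_cast Nat.succ_pos _)
    · by_cases h : eval (X : R[X]) l = 0
      · rw [h, mul_zero, degree_zero]
        exact WithBot.bot_lt_coe _
      · rw [degree_eq_natDegree h] at ih
        refine (degree_mul_le _ _).trans_lt ?_
        rw [degree_X, degree_eq_natDegree h]
        norm_cast at ih ⊢
        omega

theorem coeff_eval_X (l : List ℤ) (i : ℕ) : (eval (X : R[X]) l).coeff i = (l.getD i 0 : ℤ) := by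
  induction l generalizing i with
  | nil => simp
  | cons a l ih =>
    cases i with
    | zero =>
      rw [eval_cons, coeff_add, mul_coeff_zero, coeff_X_zero, zero_mul, add_zero, ← C_eq_intCast,
        coeff_C_zero]
      rfl
    | succ i =>
      rw [eval_cons, coeff_add, coeff_X_mul, ih, ← C_eq_intCast, coeff_C_succ, zero_add]
      rfl

theorem card_le_of_eval_eq_zero [IsDomain R] (l : List ℤ) (s : Finset R)
    (h : ∀ x ∈ s, eval x (l ++ [1]) = 0) : s.card ≤ l.length := by
  classical
  have hm : (X ^ l.length + eval (X : R[X]) l).Monic := monic_X_pow_add (degree_eval_X_lt l)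
  have hd : (X ^ l.length + eval (X : R[X]) l).natDegree = l.length := by
    rw [natDegree_add_eq_left_of_degree_lt] <;> simp [degree_eval_X_lt]
  rw [← hd]
  refine (Finset.card_le_card fun x hx ↦ ?_).trans
    ((Multiset.toFinset_card_le _).trans (card_roots' _))
  rw [Multiset.mem_toFinset, mem_roots hm.ne_zero, IsRoot, ← coe_evalRingHom, map_add, map_eval,
    coe_evalRingHom, eval_X, ← h x hx, eval_append_one]
  simp [add_comm]

theorem eval_natCast_ne_zero {n : ℕ} [CharP R n] (l : List ℤ)
    (h : ∀ b < n, eval (b : ℤ) l % (n : ℤ) ≠ 0) {b : ℕ} (hb : b < n) : eval (b : R) l ≠ 0 := by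
  intro h0
  have := map_eval (Int.castRingHom R) (b : ℤ) l
  simp only [map_natCast, h0, eq_intCast] at this
  exact h b hb (Int.emod_eq_zero_of_dvd ((CharP.intCast_eq_zero_iff R n _).1 this))

/-- The fixed points of the `n`-th power map form the prime field, where the hypothesis excludes
roots by listing the residues. -/
theorem pow_char_ne_self {L : Type*} [Field L] {n : ℕ} [Fact n.Prime] [CharP L n] (l : List ℤ)
    (h : ∀ b < n, eval (b : ℤ) l % (n : ℤ) ≠ 0) {x : L} (hx : eval x l = 0) : x ^ n ≠ x := by
  intro hpow
  rw [← Subfield.mem_bot_iff_pow_eq_self, ← ZMod.fieldRange_castHom_eq_bot n] at hpow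
  obtain ⟨b, rfl⟩ := hpow
  refine eval_natCast_ne_zero (R := L) l h b.val_lt ?_
  rwa [ZMod.castHom_apply, ← ZMod.natCast_val] at hx

end IntList

/-! ### Frobenius elements and reduction of roots -/

/-- Let `f` be an integral polynomial that splits in a Galois number field `K` and whose reduction
modulo a prime `ℓ` is separable of the same degree. Then some element of the Galois group of `K`
acts on the roots of `f` as the `ℓ`-th power map acts on the roots of the reduction. -/
theorem Polynomial.exists_frobenius (K : Type) [Field K] [CharZero K] [alg : Algebra ℚ K]
    [FiniteDimensional ℚ K] [IsGalois ℚ K] (f : ℤ[X])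
    (hf : (f.map (Int.castRingHom K)).Splits) (ℓ : ℕ) [Fact ℓ.Prime]
    (hlc : ¬ (ℓ : ℤ) ∣ f.leadingCoeff)
    (hsep : (f.map (Int.castRingHom (ZMod ℓ))).Separable) :
    ∃ (σ : Gal(K/ℚ)) (L : Type) (_ : Field L) (_ : CharP L ℓ) (red : K → L),
      ((f.map (Int.castRingHom K)).roots.map red).Nodup ∧
      ∀ x ∈ (f.map (Int.castRingHom K)).roots,
        red (σ x) = red x ^ ℓ ∧ f.eval₂ (Int.castRingHom L) (red x) = 0 := by
  -- A ℚ-algebra structure is unique, so the one that a splitting field carries may be replaced by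
  -- the canonical one of a number field.
  obtain rfl : alg = DivisionRing.toRatAlgebra := Subsingleton.elim _ _
  have : NumberField K := { }
  have hf0 : f ≠ 0 := by rintro rfl; simp at hlc
  set p := f.map (Int.castRingHom K) with hp
  have hp0 : p ≠ 0 := (Polynomial.map_ne_zero_iff (Int.castRingHom K).injective_int).2 hf0
  have hℓ : Prime (ℓ : ℤ) := Nat.prime_iff_prime_int.1 Fact.out
  have hℓmax : (Ideal.span {(ℓ : ℤ)}).IsMaximal :=
    PrincipalIdealRing.isMaximal_of_irreducible hℓ.irreducible
  obtain ⟨Q, hQm, hQ⟩ :=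
    Ideal.exists_maximal_ideal_liesOver_of_isIntegral (S := 𝓞 K) (Ideal.span {(ℓ : ℤ)})
  obtain ⟨σ, hσ⟩ := IsArithFrobAt.exists_of_isInvariant ℤ Gal(K/ℚ) Q
  have hcard : Nat.card (ℤ ⧸ Q.under ℤ) = ℓ := by rw [← hQ.over, Int.card_ideal_quot]
  let := Ideal.Quotient.field Q
  have hchar : CharP (𝓞 K ⧸ Q) ℓ := by
    refine (CharP.charP_iff_prime_eq_zero Fact.out).2 ?_
    have : (ℓ : ℤ) ∈ Q.under ℤ := hQ.over ▸ Ideal.mem_span_singleton_self _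
    simpa using Ideal.Quotient.eq_zero_iff_mem.2 (Ideal.mem_comap.1 this)
  set a := f.leadingCoeff with ha
  have haQ : (a : 𝓞 K ⧸ Q) ≠ 0 := by
    rwa [Ne, CharP.intCast_eq_zero_iff _ ℓ]
  set s := p.roots with hs
  have hint (x : K) (hx : x ∈ s) : IsIntegral ℤ ((a : K) * x) := by
    have h : aeval x f = 0 := by
      rw [hs, mem_roots hp0, hp, IsRoot, eval_map] at hx
      exact hx
    simpa using isIntegral_leadingCoeff_smul f x h
  classical
  -- As `f` need not be monic, a root `x` need not be integral, but `a * x` is. The reduction of `x`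
  -- is defined below as that of `a * x` divided by `a`, a unit modulo `Q`.
  let z (x : K) : 𝓞 K := if hx : x ∈ s then ⟨(a : K) * x, hint x hx⟩ else 0
  have hz (x : K) (hx : x ∈ s) : (z x : K) = a * x := by
    have : z x = ⟨(a : K) * x, hint x hx⟩ := dif_pos hx
    rw [this]
    rfl
  have hσs (x : K) (hx : x ∈ s) : σ x ∈ s := by
    rw [hs, mem_roots hp0, hp, IsRoot, eval_map] at hx ⊢
    have := congrArg σ hx
    rwa [← AlgEquiv.coe_ringEquiv, ← RingEquiv.coe_toRingHom, hom_eval₂, map_zero,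
      RingHom.ext_int (RingHom.comp _ _) (Int.castRingHom K)] at this
  -- The factorization into linear factors is scaled by a power of `a` so that all its coefficients
  -- are integral and it can be reduced modulo `Q`.
  have hprodK : C (a : K) ^ s.card * p =
      C (a : K) * (s.map fun x ↦ C (a : K) * X - C (a * x : K)).prod := by
    have h := hf.eq_prod_roots
    have hlead : p.leadingCoeff = a := by
      rw [hp, leadingCoeff_map_of_injective (Int.castRingHom K).injective_int]
      rfl
    rw [hlead, ← hs] at h
    have hfac (x : K) : C (a : K) * X - C (a * x : K) = C (a : K) * (X - C x) := by
      rw [C_mul, mul_sub]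
    simp_rw [hfac]
    rw [Multiset.prod_map_mul, Multiset.map_const', Multiset.prod_replicate]
    nth_rw 1 [h]
    ring
  have hprod : C (a : 𝓞 K) ^ s.card * f.map (Int.castRingHom (𝓞 K)) =
      C (a : 𝓞 K) * (s.map fun x ↦ C (a : 𝓞 K) * X - C (z x)).prod := by
    apply Polynomial.map_injective _ (RingOfIntegers.coe_injective (K := K))
    rw [Polynomial.map_mul, Polynomial.map_mul, Polynomial.map_pow, Polynomial.map_multiset_prod,
      Multiset.map_map, Polynomial.map_map]
    have h1 : (algebraMap (𝓞 K) K).comp (Int.castRingHom (𝓞 K)) = Int.castRingHom K :=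
      RingHom.ext_int _ _
    rw [h1, map_C, map_intCast, ← hp, hprodK]
    congr 2
    refine Multiset.map_congr rfl fun x hx ↦ ?_
    simp [hz x hx]
  have hprodQ : C (a : 𝓞 K ⧸ Q) ^ s.card * f.map (Int.castRingHom (𝓞 K ⧸ Q)) =
      C (a : 𝓞 K ⧸ Q) *
        (s.map fun x ↦ C (a : 𝓞 K ⧸ Q) * X - C (Ideal.Quotient.mk Q (z x))).prod := by
    have h := congrArg (Polynomial.map (Ideal.Quotient.mk Q)) hprod
    rw [Polynomial.map_mul, Polynomial.map_mul, Polynomial.map_pow, Polynomial.map_multiset_prod,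
      Multiset.map_map, Polynomial.map_map, map_C, map_intCast] at h
    have h1 : (Ideal.Quotient.mk Q).comp (Int.castRingHom (𝓞 K)) = Int.castRingHom (𝓞 K ⧸ Q) :=
      RingHom.ext_int _ _
    rw [h1] at h
    rw [h]
    congr 2
    refine Multiset.map_congr rfl fun x hx ↦ ?_
    simp
  -- Two roots with equal reductions would make the square of a linear factor divide the reduction
  -- of `f`, which is squarefree.
  have hnodup : (s.map fun x ↦ Ideal.Quotient.mk Q (z x)).Nodup := by
    rw [Multiset.nodup_iff_le]
    intro w hw
    have hsq : Squarefree (f.map (Int.castRingHom (𝓞 K ⧸ Q))) := by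
      have h1 : (ZMod.castHom dvd_rfl (𝓞 K ⧸ Q)).comp (Int.castRingHom (ZMod ℓ)) =
        Int.castRingHom (𝓞 K ⧸ Q) := RingHom.ext_int _ _
      rw [← h1, ← Polynomial.map_map]
      exact (hsep.map (f := ZMod.castHom dvd_rfl (𝓞 K ⧸ Q))).squarefree
    have hdvd := Multiset.prod_dvd_prod_of_le
      (Multiset.map_le_map (f := fun w ↦ C (a : 𝓞 K ⧸ Q) * X - C w) hw)
    rw [Multiset.map_map] at hdvd
    have hu : IsUnit (C (a : 𝓞 K ⧸ Q) ^ s.card) :=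
      (isUnit_C.2 (IsUnit.mk0 _ haQ)).pow _
    have hdvd' := hdvd.trans (Dvd.intro_left _ hprodQ.symm)
    rw [hu.dvd_mul_left] at hdvd'
    simp only [Multiset.map_cons, Multiset.map_zero, Multiset.prod_cons, Multiset.prod_zero,
      mul_one] at hdvd'
    have hd : (C (a : 𝓞 K ⧸ Q) * X - C w).degree = 1 := by
      rw [sub_eq_add_neg, ← C_neg]
      exact degree_linear haQ
    have := degree_eq_zero_of_isUnit (hsq _ hdvd')
    rw [hd] at this
    exact one_ne_zero this
  refine ⟨σ, 𝓞 K ⧸ Q, inferInstance, hchar, fun x ↦ Ideal.Quotient.mk Q (z x) / a, ?_,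
    fun x hx ↦ ⟨?_, ?_⟩⟩
  · have := hnodup.map (f := fun w ↦ w / (a : 𝓞 K ⧸ Q)) fun _ _ h ↦ (div_left_inj' haQ).1 h
    rwa [Multiset.map_map] at this
  · have h := hσ (z x)
    rw [hcard, ← Ideal.Quotient.eq, map_pow] at h
    have hzσ : z (σ x) = σ • z x := by
      apply RingOfIntegers.coe_injective (K := K)
      change (z (σ x) : K) = σ (z x)
      rw [hz _ (hσs x hx), hz _ hx, map_mul, map_intCast]
    have hapow : (a : 𝓞 K ⧸ Q) ^ ℓ = a := by
      have := congrArg (ZMod.castHom dvd_rfl (𝓞 K ⧸ Q)) (ZMod.pow_card (a : ZMod ℓ))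
      rwa [map_pow, map_intCast] at this
    change Ideal.Quotient.mk Q (z (σ x)) / _ = _
    rw [div_pow, hapow, ← h, hzσ]
    rfl
  · have h := congrArg (Polynomial.eval (Ideal.Quotient.mk Q (z x) / (a : 𝓞 K ⧸ Q))) hprodQ
    have hzero : Polynomial.eval (Ideal.Quotient.mk Q (z x) / (a : 𝓞 K ⧸ Q))
        (s.map fun x ↦ C (a : 𝓞 K ⧸ Q) * X - C (Ideal.Quotient.mk Q (z x))).prod = 0 := by
      rw [eval_multiset_prod, Multiset.map_map]
      refine Multiset.prod_eq_zero (Multiset.mem_map.2 ⟨x, hx, ?_⟩)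
      simp [mul_div_cancel₀ _ haQ]
    rw [eval_mul, eval_mul, hzero, mul_zero, eval_pow, eval_C, eval_map] at h
    exact (mul_eq_zero.1 h).resolve_left (pow_ne_zero _ haQ)

/-- The statement is carried from the splitting field to the complex roots. The root count comes for
free: reductions that are pairwise distinct come from distinct roots. -/
theorem Polynomial.exists_frobenius_gal (f : ℤ[X]) (p : ℚ[X]) (hp : f.map (Int.castRingHom ℚ) = p)
    [Fact ((p.map (algebraMap ℚ ℂ)).Splits)] (ℓ : ℕ) [Fact ℓ.Prime]
    (hlc : ¬ (ℓ : ℤ) ∣ f.leadingCoeff)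
    (hsep : (f.map (Int.castRingHom (ZMod ℓ))).Separable) :
    Nat.card (p.rootSet ℂ) = p.natDegree ∧
    ∃ (σ : p.Gal) (L : Type) (_ : Field L) (_ : CharP L ℓ) (red : p.rootSet ℂ → L),
      Function.Injective red ∧ ∀ x, red (σ • x) = red x ^ ℓ ∧
        f.eval₂ (Int.castRingHom L) (red x) = 0 := by
  let _ : Algebra ℚ p.SplittingField := SplittingField.instAlgebra_1 p
  have : Normal ℚ p.SplittingField := Normal.of_isSplittingField p
  have : IsGalois ℚ p.SplittingField := IsGalois.mk
  have hmap : f.map (Int.castRingHom p.SplittingField) = p.map (algebraMap ℚ p.SplittingField) := by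
    rw [← RingHom.ext_int ((algebraMap ℚ p.SplittingField).comp (Int.castRingHom ℚ))
      (Int.castRingHom _), ← Polynomial.map_map, hp]
  have hsplits := SplittingField.splits p
  obtain ⟨σ, L, hL, hchar, red, hred, hx⟩ :=
    exists_frobenius p.SplittingField f (hmap ▸ hsplits) ℓ hlc hsep
  rw [hmap] at hred hx
  classical
  have hcard : Nat.card (p.rootSet p.SplittingField) = p.natDegree := by
    rw [← natDegree_map (algebraMap ℚ p.SplittingField), hsplits.natDegree_eq_card_roots,
      ← Multiset.toFinset_card_of_nodup hred.of_map, rootSet_def, aroots_def]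
    exact Nat.card_eq_card_toFinset _ |>.trans (by simp)
  refine ⟨?_, σ, L, hL, hchar, fun x ↦ red ((Gal.rootsEquivRoots p ℂ).symm x), ?_, ?_⟩
  · rw [← hcard, Nat.card_congr (Gal.rootsEquivRoots p ℂ)]
  · have hmem (x : p.rootSet p.SplittingField) :
        (x : p.SplittingField) ∈ (p.map (algebraMap ℚ p.SplittingField)).roots := by
      simpa [rootSet_def, aroots_def] using x.2
    intro x y hxy
    exact (Gal.rootsEquivRoots p ℂ).symm.injective (Subtype.ext
      (Multiset.inj_on_of_nodup_map hred _ (hmem _) _ (hmem _) hxy))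
  · intro x
    have hmem (x : p.rootSet p.SplittingField) :
        (x : p.SplittingField) ∈ (p.map (algebraMap ℚ p.SplittingField)).roots := by
      simpa [rootSet_def, aroots_def] using x.2
    have := hx _ (hmem ((Gal.rootsEquivRoots p ℂ).symm x))
    have hσ : (Gal.rootsEquivRoots p ℂ).symm ((show p.Gal from σ) • x) =
        (show p.Gal from σ) • (Gal.rootsEquivRoots p ℂ).symm x := by
      rw [Gal.smul_def, Equiv.symm_apply_apply]
    refine ⟨?_, this.2⟩
    refine Eq.trans ?_ this.1
    exact congrArg (fun z : p.rootSet p.SplittingField ↦ red z) hσ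

/-! ### Permutation groups that are the full symmetric group -/

/-- A transitive group of permutations that contains a transposition and a cycle of prime length
moving all points but one is the full symmetric group. -/
theorem Subgroup.eq_top_of_isSwap_of_prime_cycle {α : Type*} [Fintype α] [DecidableEq α]
    (H : Subgroup (Equiv.Perm α)) (htrans : ∀ x y : α, ∃ g ∈ H, g x = y) {s : Equiv.Perm α}
    (hs : s ∈ H) (hswap : s.IsSwap) {a : α}
    (hcycle : ∀ x y : α, x ≠ a → y ≠ a → ∃ g ∈ H, g a = a ∧ g x = y) : H = ⊤ := by
  obtain ⟨b, c, hbc, rfl⟩ := hswap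
  have conj {x y : α} {g : Equiv.Perm α} (hg : g ∈ H) (h : Equiv.swap x y ∈ H) :
      Equiv.swap (g x) (g y) ∈ H := by
    rw [Equiv.swap_apply_apply]
    exact H.mul_mem (H.mul_mem hg h) (H.inv_mem hg)
  -- Transitivity conjugates the given transposition to one that moves `a`; the stabilizer of `a`
  -- then carries its other point to any `x`.
  have hstar (x : α) : Equiv.swap a x ∈ H := by
    obtain ⟨g, hg, hgb⟩ := htrans b a
    have hgc : g c ≠ a := hgb ▸ fun h ↦ hbc (g.injective h).symm
    by_cases hx : x = a
    · rw [hx, Equiv.swap_self]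
      exact H.one_mem
    · obtain ⟨k, hk, hka, hkx⟩ := hcycle (g c) x hgc hx
      have := conj hk (conj hg hs)
      rwa [hgb, hka, hkx] at this
  rw [eq_top_iff, ← Equiv.Perm.closure_isSwap, closure_le]
  rintro _ ⟨x, y, hxy, rfl⟩
  by_cases hx : x = a
  · exact hx ▸ hstar y
  by_cases hy : y = a
  · rw [hy, Equiv.swap_comm]
    exact hstar x
  -- Conjugating `(a y)` by `(a x)` gives `(x y)`.
  · have := conj (hstar x) (hstar y)
    rwa [Equiv.swap_apply_left, Equiv.swap_apply_of_ne_of_ne hy hxy.symm] at this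

/-- A permutation of prime order `m` is a product of disjoint `m`-cycles, and its support of `m`
points has room for just one. -/
theorem Equiv.Perm.exists_pow_apply_eq_of_prime {α : Type*} [Fintype α] [DecidableEq α] {m : ℕ}
    (hm : m.Prime) (hcard : Fintype.card α = m + 1) {τ : Equiv.Perm α} {a : α}
    (hfix : ∀ x, τ x = x ↔ x = a) (hpow : τ ^ m = 1) {x y : α} (hx : x ≠ a) (hy : y ≠ a) :
    ∃ i : ℤ, (τ ^ i) x = y := by
  have hsupp : τ.support = {a}ᶜ := by
    ext z
    simp [hfix]
  have hone : τ ≠ 1 := by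
    rintro rfl
    exact hx ((hfix x).1 rfl)
  have : Fact m.Prime := ⟨hm⟩
  have hord : orderOf τ = m := orderOf_eq_prime hpow hone
  have hcyc : τ.IsCycle := by
    refine isCycle_of_prime_order (hord ▸ hm) ?_
    rw [hsupp, hord, Finset.card_compl, hcard, Finset.card_singleton]
    have := hm.pos
    omega
  exact hcyc.exists_zpow_eq (fun h ↦ hx ((hfix x).1 h)) (fun h ↦ hy ((hfix y).1 h))

/-! ### Irreducibility from the Galois action -/

theorem Polynomial.Gal.aeval_smul {p : ℚ[X]} [Fact ((p.map (algebraMap ℚ ℂ)).Splits)] (g : p.Gal)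
    (x : p.rootSet ℂ) {q : ℚ[X]} (hq : aeval (x : ℂ) q = 0) :
    aeval ((g • x : p.rootSet ℂ) : ℂ) q = 0 := by
  let _ : Algebra ℚ p.SplittingField := SplittingField.instAlgebra_1 p
  have hcoe (z : p.rootSet p.SplittingField) :
      ((rootsEquivRoots p ℂ z : p.rootSet ℂ) : ℂ) = algebraMap p.SplittingField ℂ z := rfl
  obtain ⟨z, rfl⟩ := (rootsEquivRoots p ℂ).surjective x
  rw [smul_def, Equiv.symm_apply_apply, hcoe, aeval_algebraMap_apply]
  rw [hcoe, aeval_algebraMap_apply, map_eq_zero] at hq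
  have h : aeval (g (z : p.SplittingField)) q = 0 := by
    have := aeval_algHom_apply (AlgEquiv.toAlgHom (show Gal(p.SplittingField/ℚ) from g)) z.1 q
    exact this.trans (by rw [hq, map_zero])
  have hgz : ((g • z : p.rootSet p.SplittingField) : p.SplittingField) = g z := rfl
  rw [hgz, h, map_zero]

/-- The minimal polynomial of a root other than `a` vanishes at all roots except perhaps `a`. Its
cofactor in `p` thus has degree at most 1, and degree 1 would give a rational root. -/
theorem Polynomial.irreducible_of_gal {p : ℚ[X]} [Fact ((p.map (algebraMap ℚ ℂ)).Splits)]
    (hcard : Nat.card (p.rootSet ℂ) = p.natDegree) (hdeg : 2 ≤ p.natDegree)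
    (hroot : ∀ t, p.eval t ≠ 0) (a : p.rootSet ℂ)
    (htrans : ∀ x y : p.rootSet ℂ, x ≠ a → y ≠ a → ∃ g : p.Gal, g • x = y) : Irreducible p := by
  have hp0 : p ≠ 0 := by
    rintro rfl
    simp at hdeg
  have hfin : Finite (p.rootSet ℂ) := inferInstance
  obtain ⟨x, hx⟩ : ∃ x, x ≠ a := by
    have : Nontrivial (p.rootSet ℂ) := Finite.one_lt_card_iff_nontrivial.1 (by omega)
    exact exists_ne a
  have hxp : aeval (x : ℂ) p = 0 := (mem_rootSet.1 x.2).2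
  have hxint : IsIntegral ℚ (x : ℂ) := (isAlgebraic_iff_isIntegral).1 ⟨p, hp0, hxp⟩
  obtain ⟨r, hr⟩ := minpoly.dvd ℚ (x : ℂ) hxp
  set q := minpoly ℚ (x : ℂ) with hq
  have hq0 : q ≠ 0 := minpoly.ne_zero hxint
  have hr0 : r ≠ 0 := by
    rintro rfl
    exact hp0 (by rw [hr, mul_zero])
  have hqroots (y : p.rootSet ℂ) (hy : y ≠ a) : (y : ℂ) ∈ q.rootSet ℂ := by
    obtain ⟨g, rfl⟩ := htrans x y hx hy
    exact mem_rootSet.2 ⟨hq0, Gal.aeval_smul g x (minpoly.aeval ℚ (x : ℂ))⟩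
  have hqdeg : p.natDegree - 1 ≤ q.natDegree := by
    classical
    have h1 : p.rootSet ℂ \ {(a : ℂ)} ⊆ q.rootSet ℂ := by
      rintro y ⟨hy, hya⟩
      exact hqroots ⟨y, hy⟩ fun h ↦ hya (congrArg Subtype.val h)
    have h2 := Set.ncard_le_ncard h1 (Set.toFinite _)
    rw [Set.ncard_sdiff_singleton_of_mem a.2, ← Nat.card_coe_set_eq, hcard] at h2
    refine h2.trans ?_
    rw [rootSet_def, Set.ncard_coe_finset]
    refine (Multiset.toFinset_card_le _).trans ((card_roots' _).trans natDegree_map_le)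
  have hsum : p.natDegree = q.natDegree + r.natDegree := by
    rw [hr, natDegree_mul hq0 hr0]
  have hrdeg : r.natDegree ≠ 1 := by
    intro h
    obtain ⟨t, ht⟩ :=
      exists_root_of_degree_eq_one ((degree_eq_iff_natDegree_eq_of_pos one_pos).2 h)
    refine hroot t ?_
    rw [hr, eval_mul, ht.eq_zero, mul_zero]
  have hru : IsUnit r := by
    rw [isUnit_iff_degree_eq_zero, degree_eq_natDegree hr0]
    have : r.natDegree = 0 := by omega
    rw [this]
    rfl
  rw [hr]
  exact (irreducible_mul_isUnit hru).2 (minpoly.irreducible hxint)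

/-! ### Certificates modulo a prime -/

namespace IntList

theorem natDegree_eval_X {R : Type*} [CommRing R] [CharZero R] {f : List ℤ} {n : ℕ}
    (hlen : f.length = n + 1) (hlead : f.getD n 0 ≠ 0) : (eval (X : R[X]) f).natDegree = n := by
  apply natDegree_eq_of_le_of_coeff_ne_zero
  · have h := degree_eval_X_lt (R := R) f
    rw [hlen] at h
    refine natDegree_le_iff_coeff_eq_zero.2 fun i hi ↦ ?_
    exact coeff_eq_zero_of_degree_lt (h.trans_le (by exact_mod_cast hi))
  · rw [coeff_eval_X]
    exact Int.cast_ne_zero.2 hlead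

/-- The polynomial with coefficients `f` has degree `f.length - 1` and is separable modulo `ℓ`;
here `a` and `b` are the coefficients in a Bézout relation between it and its derivative. -/
structure SeparableMod (ℓ : ℕ) (f a b : List ℤ) : Prop where
  lead : f.getD (f.length - 1) 0 % (ℓ : ℤ) ≠ 0
  bezout : mod ℓ (add (mul a f) (mul b (derivative f))) = mod ℓ [1]

/-- The polynomial `f` is `c * (u + X ^ u.length) * (v + X ^ v.length)` modulo `ℓ`. -/
structure FactorsMod (ℓ : ℕ) (f : List ℤ) (c : ℤ) (u v : List ℤ) : Prop where
  unit : c % (ℓ : ℤ) ≠ 0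
  length : f.length = u.length + v.length + 1
  eq : mod ℓ f = mod ℓ (smul c (mul (u ++ [1]) (v ++ [1])))

theorem FactorsMod.eval_eq_zero {ℓ : ℕ} {f u v : List ℤ} {c : ℤ} (h : FactorsMod ℓ f c u v)
    {L : Type*} [Field L] [CharP L ℓ] {x : L} (hx : eval x f = 0) :
    eval x (u ++ [1]) = 0 ∨ eval x (v ++ [1]) = 0 := by
  have hc : (c : L) ≠ 0 := fun h0 ↦
    h.unit (Int.emod_eq_zero_of_dvd ((CharP.intCast_eq_zero_iff L ℓ c).1 h0))
  rw [eval_eq_of_mod_eq x h.eq, eval_smul, eval_mul] at hx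
  exact mul_eq_zero.1 ((mul_eq_zero.1 hx).resolve_left hc)

/-- An injective family of more than `l.length` elements is not contained in the roots of the monic
polynomial `l ++ [1]`. -/
theorem exists_eval_ne_zero {α L : Type*} [Finite α] [Field L] {red : α → L}
    (hinj : Function.Injective red) {l : List ℤ} (hcard : l.length < Nat.card α) :
    ∃ x, eval (red x) (l ++ [1]) ≠ 0 := by
  by_contra! h
  classical
  have := Fintype.ofFinite α
  have := card_le_of_eval_eq_zero l (Finset.univ.image red) (by simpa using h)
  rw [Finset.card_image_of_injective _ hinj, Finset.card_univ, ← Nat.card_eq_fintype_card] at this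
  omega

variable {f : List ℤ} {ℓ : ℕ} [hℓ : Fact ℓ.Prime] {a b : List ℤ}
  [Fact (((eval (X : ℚ[X]) f).map (algebraMap ℚ ℂ)).Splits)]

theorem SeparableMod.exists_frobenius (h : SeparableMod ℓ f a b) :
    Nat.card ((eval (X : ℚ[X]) f).rootSet ℂ) = f.length - 1 ∧
    (eval (X : ℚ[X]) f).natDegree = f.length - 1 ∧
    ∃ (σ : (eval (X : ℚ[X]) f).Gal) (L : Type) (_ : Field L) (_ : CharP L ℓ)
      (red : (eval (X : ℚ[X]) f).rootSet ℂ → L),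
      Function.Injective red ∧
      (∀ (k : ℕ) (x : (eval (X : ℚ[X]) f).rootSet ℂ), red (σ ^ k • x) = red x ^ ℓ ^ k) ∧
      ∀ x, eval (red x) f = 0 := by
  have hlead : f.getD (f.length - 1) 0 ≠ 0 := fun h0 ↦ h.lead (by rw [h0, Int.zero_emod])
  have hlen : f.length = f.length - 1 + 1 := by
    rcases f with _ | ⟨c, f⟩
    · simp at hlead
    · simp
  have hp : (eval (X : ℤ[X]) f).map (Int.castRingHom ℚ) = eval (X : ℚ[X]) f := by
    rw [← coe_mapRingHom, map_eval, coe_mapRingHom, map_X]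
  have hdeg : (eval (X : ℤ[X]) f).natDegree = f.length - 1 := natDegree_eval_X hlen hlead
  obtain ⟨hcard, σ, L, hL, hchar, red, hinj, hred⟩ :=
    Polynomial.exists_frobenius_gal (eval X f) (eval X f) hp ℓ
    (by
      rw [leadingCoeff, hdeg, coeff_eval_X, Int.cast_id]
      exact fun h0 ↦ h.lead (Int.emod_eq_zero_of_dvd h0))
    (by
      have hmap : (eval (X : ℤ[X]) f).map (Int.castRingHom (ZMod ℓ)) =
          eval (X : (ZMod ℓ)[X]) f := by
        rw [← coe_mapRingHom, map_eval, coe_mapRingHom, map_X]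
      have h1 := eval_eq_of_mod_eq (X : (ZMod ℓ)[X]) h.bezout
      rw [eval_add, eval_mul, eval_mul, ← derivative_eval_X] at h1
      rw [hmap]
      exact ⟨_, _, h1.trans (by simp)⟩)
  have hdegQ : (eval (X : ℚ[X]) f).natDegree = f.length - 1 := natDegree_eval_X hlen hlead
  refine ⟨hcard.trans hdegQ, hdegQ, σ, L, hL, hchar, red, hinj, fun k ↦ ?_, fun x ↦ ?_⟩
  · induction k with
    | zero => simp
    | succ k ih => intro x; rw [pow_succ', mul_smul, (hred _).1, ih, ← pow_mul, pow_succ]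
  · have h2 := (hred x).2
    rwa [← coe_eval₂RingHom, map_eval, coe_eval₂RingHom, eval₂_X] at h2

/-- A rational root is fixed by the Frobenius element, so its reduction is fixed by the `ℓ`-th power
map and is a root in the prime field. -/
theorem SeparableMod.eval_ne_zero (h : SeparableMod ℓ f a b)
    (hroot : ∀ t < ℓ, eval (t : ℤ) f % (ℓ : ℤ) ≠ 0) (t : ℚ) : (eval (X : ℚ[X]) f).eval t ≠ 0 := by
  intro ht
  obtain ⟨-, -, σ, L, _, _, red, hinj, hred, hzero⟩ := h.exists_frobenius
  have hf : eval (X : ℚ[X]) f ≠ 0 := by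
    intro h0
    have hlead : f.getD (f.length - 1) 0 ≠ 0 := fun h0 ↦ h.lead (by rw [h0, Int.zero_emod])
    have := coeff_eval_X (R := ℚ) f (f.length - 1)
    rw [h0, coeff_zero] at this
    exact hlead (Int.cast_eq_zero.1 this.symm)
  have hx : (t : ℂ) ∈ (eval (X : ℚ[X]) f).rootSet ℂ := by
    rw [mem_rootSet_of_ne hf, ← eq_ratCast (algebraMap ℚ ℂ), aeval_algebraMap_apply,
      coe_aeval_eq_eval, ht, map_zero]
  have hfix : σ • (⟨t, hx⟩ : (eval (X : ℚ[X]) f).rootSet ℂ) = ⟨t, hx⟩ := by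
    have h1 : aeval (t : ℂ) (X - C t) = 0 := by simp
    have h2 := Gal.aeval_smul σ ⟨(t : ℂ), hx⟩ h1
    simp only [aeval_sub, aeval_X, aeval_C, sub_eq_zero] at h2
    exact Subtype.ext (h2.trans (by simp))
  have h3 := hred 1 ⟨t, hx⟩
  rw [pow_one, hfix, pow_one] at h3
  exact pow_char_ne_self f hroot (hzero _) h3.symm

/-- If `f` is the product modulo `ℓ` of a linear and an irreducible polynomial of prime degree, then
its Galois group acts transitively on the roots other than some root `a`, and fixes `a`. -/
theorem SeparableMod.exists_cycle (h : SeparableMod ℓ f a b) {c u : ℤ} {v : List ℤ}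
    (hfac : FactorsMod ℓ f c [u] v) (hv : v.length.Prime)
    (hroot : ∀ t < ℓ, eval (t : ℤ) (v ++ [1]) % (ℓ : ℤ) ≠ 0)
    (hpow : frobMod ℓ (v ++ [1]) v.length = [0, 1]) :
    ∃ z : (eval (X : ℚ[X]) f).rootSet ℂ, ∀ x y, x ≠ z → y ≠ z →
      ∃ g : (eval (X : ℚ[X]) f).Gal, g • z = z ∧ g • x = y := by
  obtain ⟨hcard, -, σ, L, _, _, red, hinj, hred, hzero⟩ := h.exists_frobenius
  have hcard' : Nat.card ((eval (X : ℚ[X]) f).rootSet ℂ) = v.length + 1 := by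
    rw [hcard, hfac.length, List.length_singleton]
    omega
  obtain ⟨z, hz⟩ := exists_eval_ne_zero hinj (l := v) (by omega)
  have hlin (x : (eval (X : ℚ[X]) f).rootSet ℂ) : eval (red x) (v ++ [1]) ≠ 0 →
      red x = ((-u : ℤ) : L) := by
    intro hx
    have := (hfac.eval_eq_zero (hzero x)).resolve_right hx
    push_cast
    simp only [List.cons_append, List.nil_append, eval_cons, eval_nil] at this
    push_cast at this
    linear_combination this
  -- The root of the linear factor reduces into the prime field and is fixed; a root of `v` is
  -- moved, since `v` has no root there.
  have hfixed (x : (eval (X : ℚ[X]) f).rootSet ℂ) : σ • x = x ↔ x = z := by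
    have h1 := hred 1 x
    rw [pow_one, pow_one] at h1
    constructor
    · intro hx
      rw [hx] at h1
      refine hinj ((hlin x fun h0 ↦ ?_).trans (hlin z hz).symm)
      exact pow_char_ne_self _ hroot h0 h1.symm
    · rintro rfl
      apply hinj
      rw [h1, hlin x hz]
      have := congrArg (ZMod.castHom dvd_rfl L) (ZMod.pow_card ((-u : ℤ) : ZMod ℓ))
      rwa [map_pow, map_intCast] at this
  -- `hpow` says that `X ^ ℓ ^ v.length` is `X` modulo `v`. Together with `hfixed` it replaces a
  -- test of irreducibility of `v`: the order of `σ` is prime and only `z` is fixed.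
  have hone (x : (eval (X : ℚ[X]) f).rootSet ℂ) : σ ^ v.length • x = x := by
    by_cases hx : eval (red x) (v ++ [1]) = 0
    · apply hinj
      rw [hred, ← eval_frobMod hx, hpow]
      simp
    · obtain rfl := hinj ((hlin x hx).trans (hlin z hz).symm)
      have (j : ℕ) : σ ^ j • x = x := by
        induction j with
        | zero => rw [pow_zero, one_smul]
        | succ j ih => rw [pow_succ, mul_smul, (hfixed x).2 rfl, ih]
      exact this _
  refine ⟨z, fun x y hx hy ↦ ?_⟩
  classical
  have := Fintype.ofFinite ((eval (X : ℚ[X]) f).rootSet ℂ)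
  let τ := MulAction.toPermHom (eval (X : ℚ[X]) f).Gal ((eval (X : ℚ[X]) f).rootSet ℂ) σ
  have hτ : τ ^ v.length = 1 := by
    ext x
    rw [← map_pow]
    exact congrArg Subtype.val (hone x)
  obtain ⟨i, hi⟩ := Equiv.Perm.exists_pow_apply_eq_of_prime hv
    (Nat.card_eq_fintype_card.symm.trans hcard') (τ := τ) (a := z) hfixed hτ hx hy
  refine ⟨σ ^ i, ?_, ?_⟩
  · change MulAction.toPermHom _ _ (σ ^ i) z = z
    rw [map_zpow]
    exact Equiv.Perm.zpow_apply_eq_self_of_apply_eq_self ((hfixed z).2 rfl) i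
  · change MulAction.toPermHom _ _ (σ ^ i) x = y
    rw [map_zpow]
    exact hi

/-- If modulo `ℓ` the polynomial `f` is the product of `u`, whose roots are fixed by `X ^ ℓ ^ k`,
and of a quadratic polynomial `v`, whose roots are not, then the Galois group contains a
transposition; `w` is the inverse of `X ^ ℓ ^ k - X` modulo `v`. -/
theorem SeparableMod.exists_isSwap (h : SeparableMod ℓ f a b) {c : ℤ} {u v w : List ℤ} {k : ℕ}
    (hfac : FactorsMod ℓ f c u v) (hv : v.length = 2)
    (hpow : frobMod ℓ (u ++ [1]) k = [0, 1])
    (hinv : mulMod ℓ (v ++ [1]) w (sub (frobMod ℓ (v ++ [1]) k) [0, 1]) = [1])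
    [DecidableEq ((eval (X : ℚ[X]) f).rootSet ℂ)] :
    ∃ g : (eval (X : ℚ[X]) f).Gal, (Gal.galActionHom (eval (X : ℚ[X]) f) ℂ g).IsSwap := by
  obtain ⟨hcard, -, σ, L, _, _, red, hinj, hred, hzero⟩ := h.exists_frobenius
  have hcard' : Nat.card ((eval (X : ℚ[X]) f).rootSet ℂ) = u.length + 2 := by
    rw [hcard, hfac.length, hv]
    omega
  have := Classical.decEq L
  have := Fintype.ofFinite ((eval (X : ℚ[X]) f).rootSet ℂ)
  refine ⟨σ ^ k, ?_⟩
  set τ := Gal.galActionHom (eval (X : ℚ[X]) f) ℂ (σ ^ k) with hτ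
  have hτx (x) : red (τ x) = red x ^ ℓ ^ k := hred k x
  rw [← Equiv.Perm.card_support_eq_two]
  -- Roots that reduce to roots of `u` are fixed, so only the at most two that reduce to roots of
  -- `v` can move.
  have hle : τ.support.card ≤ 2 := by
    rw [← Finset.card_image_of_injective _ hinj, ← hv]
    refine card_le_of_eval_eq_zero v _ fun y hy ↦ ?_
    obtain ⟨x, hx, rfl⟩ := Finset.mem_image.1 hy
    refine (hfac.eval_eq_zero (hzero x)).resolve_left fun h0 ↦ ?_
    refine Equiv.Perm.mem_support.1 hx (hinj ?_)
    rw [hτx, ← eval_frobMod h0, hpow]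
    simp
  -- `u` has too few roots to take all reductions, so some root reduces to a root of `v`; there `X ^
  -- ℓ ^ k - X` is invertible by `hinv` and cannot vanish.
  have hne : τ ≠ 1 := by
    intro h1
    obtain ⟨x, hx⟩ := exists_eval_ne_zero hinj (l := u) (by omega)
    have h0 := (hfac.eval_eq_zero (hzero x)).resolve_left hx
    have h2 := hτx x
    rw [h1, Equiv.Perm.one_apply] at h2
    have h3 := congrArg (eval (red x)) hinv
    rw [eval_mulMod h0, eval_sub, eval_frobMod h0, ← h2] at h3
    simp at h3
  have h0 : τ.support.card ≠ 0 := by simpa using hne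
  have h1 := Equiv.Perm.card_support_ne_one τ
  omega

/-- The prime `ℓ₁` supplies the cycle, `ℓ₂` the transposition, and `ℓ₃` the absence of rational
roots. -/
theorem irreducible_and_hasFullSymmetricGaloisGroup (f : List ℤ) (p : ℚ[X])
    (hp : eval X f = p)
    {ℓ₁ ℓ₂ ℓ₃ : ℕ} [Fact ℓ₁.Prime] [Fact ℓ₂.Prime] [Fact ℓ₃.Prime]
    {a₁ b₁ a₂ b₂ a₃ b₃ v₁ u₂ v₂ w₂ : List ℤ} {c₁ c₂ u₁ : ℤ} {k : ℕ}
    (h₁ : SeparableMod ℓ₁ f a₁ b₁) (h₂ : SeparableMod ℓ₂ f a₂ b₂) (h₃ : SeparableMod ℓ₃ f a₃ b₃)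
    (hfac₁ : FactorsMod ℓ₁ f c₁ [u₁] v₁) (hv₁ : v₁.length.Prime)
    (hroot₁ : ∀ t < ℓ₁, eval (t : ℤ) (v₁ ++ [1]) % (ℓ₁ : ℤ) ≠ 0)
    (hpow₁ : frobMod ℓ₁ (v₁ ++ [1]) v₁.length = [0, 1])
    (hfac₂ : FactorsMod ℓ₂ f c₂ u₂ v₂) (hv₂ : v₂.length = 2)
    (hpow₂ : frobMod ℓ₂ (u₂ ++ [1]) k = [0, 1])
    (hinv₂ : mulMod ℓ₂ (v₂ ++ [1]) w₂ (sub (frobMod ℓ₂ (v₂ ++ [1]) k) [0, 1]) = [1])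
    (hroot₃ : ∀ t < ℓ₃, eval (t : ℤ) f % (ℓ₃ : ℤ) ≠ 0) :
    Irreducible p ∧ HasFullSymmetricGaloisGroup p := by
  subst hp
  have : Fact (((eval (X : ℚ[X]) f).map (algebraMap ℚ ℂ)).Splits) := ⟨IsAlgClosed.splits _⟩
  classical
  have := Fintype.ofFinite ((eval (X : ℚ[X]) f).rootSet ℂ)
  obtain ⟨z, hz⟩ := h₁.exists_cycle hfac₁ hv₁ hroot₁ hpow₁
  obtain ⟨s, hs⟩ := h₂.exists_isSwap hfac₂ hv₂ hpow₂ hinv₂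
  obtain ⟨hcard, hdeg, -⟩ := h₁.exists_frobenius
  have hlen := hfac₁.length
  rw [List.length_singleton] at hlen
  have hirr : Irreducible (eval (X : ℚ[X]) f) := by
    refine irreducible_of_gal (hcard.trans hdeg.symm) ?_ (h₃.eval_ne_zero hroot₃) z
      fun x y hx hy ↦ (hz x y hx hy).imp fun g hg ↦ hg.2
    have := hv₁.pos
    omega
  refine ⟨hirr, Gal.galActionHom_injective _ _, MonoidHom.range_eq_top.1 ?_⟩
  have := Gal.galAction_isPretransitive (E := ℂ) _ hirr
  refine Subgroup.eq_top_of_isSwap_of_prime_cycle _ (fun x y ↦ ?_) ⟨s, rfl⟩ hs (a := z)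
    fun x y hx hy ↦ ?_
  · obtain ⟨g, hg⟩ := MulAction.exists_smul_eq (eval (X : ℚ[X]) f).Gal x y
    exact ⟨_, ⟨g, rfl⟩, hg⟩
  · obtain ⟨g, hgz, hg⟩ := hz x y hx hy
    exact ⟨_, ⟨g, rfl⟩, hgz, hg⟩

/-! ### The four factors of the eliminant -/

/-- The coefficients of a factor of the eliminant that belongs to one relative orientation of the
two triangles. -/
def sexticOne : List ℤ :=
  [729792028897401199189828400425467904, 66309290047263296564551993922682880,
  2651386866015459106094993538809856, 35027562955065116649517918191616,
  -360002018815331633197947551744, -6099074441845770730610884608, 54319315617113273423364096]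

theorem irreducible_and_hasFullSymmetricGaloisGroup_sexticOne :
    Irreducible (eval (X : ℚ[X]) sexticOne) ∧ HasFullSymmetricGaloisGroup (eval X sexticOne) := by
  have : Fact (Nat.Prime 19) := ⟨by norm_num⟩
  have : Fact (Nat.Prime 17) := ⟨by norm_num⟩
  have : Fact (Nat.Prime 23) := ⟨by norm_num⟩
  refine irreducible_and_hasFullSymmetricGaloisGroup sexticOne _ rfl
    -- The lists `aᵢ`, `bᵢ` are Bézout coefficients modulo each prime. Modulo 19 the factors are
    -- linear and an irreducible quintic. Modulo 17 the quadratic `v₂` is irreducible, while the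
    -- roots of `u₂` lie in the field of 17³ elements; `k` is odd, so the cube of Frobenius still
    -- exchanges the roots of `v₂`. The octics use `k = 5` in the same way.
    (ℓ₁ := 19) (ℓ₂ := 17) (ℓ₃ := 23)
    (a₁ := [7, 7, 2, 8, 8]) (b₁ := [15, 7, 17, 7, 15, 5])
    (a₂ := [1, 5, 9, 6, 2]) (b₂ := [6, 2, 8, 11, 0, 11])
    (a₃ := [2, 16, 20, 9, 10]) (b₃ := [22, 11, 1, 16, 6, 6])
    (c₁ := 4) (u₁ := 13) (v₁ := [2, 8, 7, 3, 18])
    (c₂ := 1) (u₂ := [16, 0, 9, 8]) (v₂ := [2, 8])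
    (w₂ := [12, 3]) (k := 3)
    ⟨?_, ?_⟩ ⟨?_, ?_⟩ ⟨?_, ?_⟩ ⟨?_, ?_, ?_⟩ (by norm_num) ?_ ?_ ⟨?_, ?_, ?_⟩ rfl ?_ ?_ ?_ <;>
  decide +kernel

/-- The coefficients of the factor of the eliminant that belongs to the other relative
orientation of the two triangles. -/
def sexticTwo : List ℤ :=
  [1152246393155768464, -776224290995754200, 69050497529701041, -615688594921544,
  -17613405584624, 143122194432, 2747437056]

theorem irreducible_and_hasFullSymmetricGaloisGroup_sexticTwo :
    Irreducible (eval (X : ℚ[X]) sexticTwo) ∧ HasFullSymmetricGaloisGroup (eval X sexticTwo) := by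
  have : Fact (Nat.Prime 37) := ⟨by norm_num⟩
  have : Fact (Nat.Prime 17) := ⟨by norm_num⟩
  have : Fact (Nat.Prime 19) := ⟨by norm_num⟩
  refine irreducible_and_hasFullSymmetricGaloisGroup sexticTwo _ rfl
    (ℓ₁ := 37) (ℓ₂ := 17) (ℓ₃ := 19)
    (a₁ := [8, 32, 1, 13, 23]) (b₁ := [15, 30, 29, 0, 2, 27])
    (a₂ := [4, 5, 4, 8, 16]) (b₂ := [5, 9, 2, 15, 16, 3])
    (a₃ := [4, 10, 3, 17, 1]) (b₃ := [1, 10, 3, 12, 12, 3])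
    (c₁ := 21) (u₁ := 4) (v₁ := [7, 24, 31, 2, 12])
    (c₂ := 8) (u₂ := [16, 2, 12, 14]) (v₂ := [15, 15])
    (w₂ := [3, 14]) (k := 3)
    ⟨?_, ?_⟩ ⟨?_, ?_⟩ ⟨?_, ?_⟩ ⟨?_, ?_, ?_⟩ (by norm_num) ?_ ?_ ⟨?_, ?_, ?_⟩ rfl ?_ ?_ ?_ <;>
  decide +kernel

/-- The coefficients of a factor of the eliminant whose roots do not come from placements. -/
def octicOne : List ℤ :=
  [13663404945744016, 813935120915198504, -299095702632348879, -46366435207277752,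
  16575444136627160, 1002422141698336, -202247115019760, -5275493184000, 731161600000]

theorem irreducible_and_hasFullSymmetricGaloisGroup_octicOne :
    Irreducible (eval (X : ℚ[X]) octicOne) ∧ HasFullSymmetricGaloisGroup (eval X octicOne) := by
  have : Fact (Nat.Prime 17) := ⟨by norm_num⟩
  have : Fact (Nat.Prime 37) := ⟨by norm_num⟩
  have : Fact (Nat.Prime 11) := ⟨by norm_num⟩
  refine irreducible_and_hasFullSymmetricGaloisGroup octicOne _ rfl
    (ℓ₁ := 17) (ℓ₂ := 37) (ℓ₃ := 11)
    (a₁ := [11, 0, 3, 6, 13, 12, 15]) (b₁ := [7, 11, 16, 8, 7, 15, 5, 13])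
    (a₂ := [11, 11, 4, 34, 17, 8, 14]) (b₂ := [32, 28, 7, 28, 34, 8, 15, 26])
    (a₃ := [9, 8, 5, 6, 8, 2, 7]) (b₃ := [7, 4, 4, 9, 6, 4, 5, 6])
    (c₁ := 6) (u₁ := 16) (v₁ := [10, 6, 5, 9, 13, 1, 5])
    (c₂ := 12) (u₂ := [16, 5, 24, 14, 22, 34]) (v₂ := [12, 25])
    (w₂ := [14, 10]) (k := 5)
    ⟨?_, ?_⟩ ⟨?_, ?_⟩ ⟨?_, ?_⟩ ⟨?_, ?_, ?_⟩ (by norm_num) ?_ ?_ ⟨?_, ?_, ?_⟩ rfl ?_ ?_ ?_ <;>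
  decide +kernel

/-- The coefficients of the other factor whose roots do not come from placements. -/
def octicTwo : List ℤ :=
  [1620713038685642896, 4022769219537416744, -1119855862049129679, -104245652941659832,
  29180343859430360, 929745074065696, -254604702168560, -2884724544000, 731161600000]

theorem irreducible_and_hasFullSymmetricGaloisGroup_octicTwo :
    Irreducible (eval (X : ℚ[X]) octicTwo) ∧ HasFullSymmetricGaloisGroup (eval X octicTwo) := by
  have : Fact (Nat.Prime 31) := ⟨by norm_num⟩
  have : Fact (Nat.Prime 17) := ⟨by norm_num⟩
  have : Fact (Nat.Prime 29) := ⟨by norm_num⟩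
  refine irreducible_and_hasFullSymmetricGaloisGroup octicTwo _ rfl
    (ℓ₁ := 31) (ℓ₂ := 17) (ℓ₃ := 29)
    (a₁ := [14, 29, 5, 29, 17, 12, 23]) (b₁ := [2, 23, 27, 15, 0, 16, 17, 1])
    (a₂ := [1, 1, 5, 8, 8, 7, 8]) (b₂ := [7, 12, 16, 10, 5, 16, 15, 16])
    (a₃ := [0, 22, 24, 1, 17, 2, 6]) (b₃ := [25, 7, 10, 9, 0, 23, 3, 21])
    (c₁ := 16) (u₁ := 24) (v₁ := [12, 15, 17, 21, 19, 17, 0])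
    (c₂ := 6) (u₂ := [14, 15, 10, 13, 16, 14]) (v₂ := [9, 12])
    (w₂ := [15, 11]) (k := 5)
    ⟨?_, ?_⟩ ⟨?_, ?_⟩ ⟨?_, ?_⟩ ⟨?_, ?_, ?_⟩ (by norm_num) ?_ ?_ ⟨?_, ?_, ?_⟩ rfl ?_ ?_ ?_ <;>
  decide +kernel

end IntList

/-! ### Resultants of quadratic and quartic polynomials -/

section Resultant

variable {R : Type*} [CommRing R]

theorem Matrix.det_fin_four (M : Matrix (Fin 4) (Fin 4) R) : M.det =
    M 0 0 * (M 1 1 * (M 2 2 * M 3 3 - M 2 3 * M 3 2) - M 1 2 * (M 2 1 * M 3 3 - M 2 3 * M 3 1)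
      + M 1 3 * (M 2 1 * M 3 2 - M 2 2 * M 3 1))
    - M 0 1 * (M 1 0 * (M 2 2 * M 3 3 - M 2 3 * M 3 2) - M 1 2 * (M 2 0 * M 3 3 - M 2 3 * M 3 0)
      + M 1 3 * (M 2 0 * M 3 2 - M 2 2 * M 3 0))
    + M 0 2 * (M 1 0 * (M 2 1 * M 3 3 - M 2 3 * M 3 1) - M 1 1 * (M 2 0 * M 3 3 - M 2 3 * M 3 0)
      + M 1 3 * (M 2 0 * M 3 1 - M 2 1 * M 3 0))
    - M 0 3 * (M 1 0 * (M 2 1 * M 3 2 - M 2 2 * M 3 1) - M 1 1 * (M 2 0 * M 3 2 - M 2 2 * M 3 0)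
      + M 1 2 * (M 2 0 * M 3 1 - M 2 1 * M 3 0)) := by
  rw [Matrix.det_succ_row_zero]
  simp only [Fin.sum_univ_four, Matrix.det_fin_three, Matrix.submatrix_apply]
  simp [Fin.succAbove, Fin.lt_def]
  ring

theorem Polynomial.resultant_quadratic (a₀ a₁ a₂ b₀ b₁ b₂ : R) :
    resultant (C a₂ * X ^ 2 + C a₁ * X + C a₀) (C b₂ * X ^ 2 + C b₁ * X + C b₀) 2 2 =
      (a₀ * b₂ - a₂ * b₀) ^ 2 - (a₀ * b₁ - a₁ * b₀) * (a₁ * b₂ - a₂ * b₁) := by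
  have h : sylvester (C a₂ * X ^ 2 + C a₁ * X + C a₀) (C b₂ * X ^ 2 + C b₁ * X + C b₀) 2 2 =
      !![b₀, 0, a₀, 0; b₁, b₀, a₁, a₀; b₂, b₁, a₂, a₁; 0, b₂, 0, a₂] := by
    ext i j
    fin_cases i <;> fin_cases j <;>
    simp [sylvester, Fin.addCases, coeff_X, coeff_C]
  rw [resultant, h, Matrix.det_fin_four]
  simp
  ring

/-- The determinant of the Bézout matrix of two quartic polynomials with coefficients `f` and `g`,
in terms of given operations. -/
def bezoutDet {α : Type*} (add sub mul : α → α → α) (f g : ℕ → α) : α :=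
  let b (i j : ℕ) : α := sub (mul (f i) (g j)) (mul (g i) (f j))
  let z₁₁ := add (b 4 0) (b 3 1)
  let z₁₂ := add (b 3 0) (b 2 1)
  let z₂₁ := add (b 4 1) (b 3 2)
  let minor (x y z w : α) : α := sub (mul x w) (mul y z)
  let m₀₁ := minor (b 4 2) z₂₁ (b 4 3) (b 4 2)
  let m₀₂ := minor (b 4 2) z₁₁ (b 4 3) (b 4 1)
  let m₀₃ := minor (b 4 2) (b 3 0) (b 4 3) (b 4 0)
  let m₁₂ := minor z₂₁ z₁₁ (b 4 2) (b 4 1)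
  let m₁₃ := minor z₂₁ (b 3 0) (b 4 2) (b 4 0)
  let m₂₃ := minor z₁₁ (b 3 0) (b 4 1) (b 4 0)
  sub (add (sub
    (mul (b 4 0) (add (sub (mul z₁₁ m₂₃) (mul z₁₂ m₁₃)) (mul (b 2 0) m₁₂)))
    (mul (b 3 0) (add (sub (mul (b 4 1) m₂₃) (mul z₁₂ m₀₃)) (mul (b 2 0) m₀₂))))
    (mul (b 2 0) (add (sub (mul (b 4 1) m₁₃) (mul z₁₁ m₀₃)) (mul (b 2 0) m₀₁))))
    (mul (b 1 0) (add (sub (mul (b 4 1) m₁₂) (mul z₁₁ m₀₂)) (mul z₁₂ m₀₁)))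

/-- The upper half of the columns of a quartic polynomial in a Sylvester matrix. -/
def lowerToeplitz (p : R[X]) : Matrix (Fin 4) (Fin 4) R :=
  .of fun i j ↦ if j ≤ i then p.coeff (i - j) else 0

/-- The lower half of the columns of a quartic polynomial in a Sylvester matrix. -/
def upperToeplitz (p : R[X]) : Matrix (Fin 4) (Fin 4) R :=
  .of fun i j ↦ if i ≤ j then p.coeff (4 + i - j) else 0

theorem lowerToeplitz_eq (p : R[X]) : lowerToeplitz p =
    !![p.coeff 0, 0, 0, 0; p.coeff 1, p.coeff 0, 0, 0; p.coeff 2, p.coeff 1, p.coeff 0, 0;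
      p.coeff 3, p.coeff 2, p.coeff 1, p.coeff 0] := by
  ext i j
  fin_cases i <;> fin_cases j <;> rfl

theorem upperToeplitz_eq (p : R[X]) : upperToeplitz p =
    !![p.coeff 4, p.coeff 3, p.coeff 2, p.coeff 1; 0, p.coeff 4, p.coeff 3, p.coeff 2;
      0, 0, p.coeff 4, p.coeff 3; 0, 0, 0, p.coeff 4] := by
  ext i j
  fin_cases i <;> fin_cases j <;> rfl

theorem sylvester_submatrix_finSumFinEquiv (f g : R[X]) :
    (sylvester f g 4 4).submatrix finSumFinEquiv finSumFinEquiv =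
      Matrix.fromBlocks (lowerToeplitz g) (lowerToeplitz f) (upperToeplitz g)
        (upperToeplitz f) := by
  ext i j
  rcases i with i | i <;> rcases j with j | j <;>
  · simp only [Matrix.submatrix_apply, finSumFinEquiv_apply_left, finSumFinEquiv_apply_right,
      sylvester, Matrix.of_apply, Fin.addCases_left, Fin.addCases_right, Matrix.fromBlocks_apply₁₁,
      Matrix.fromBlocks_apply₁₂, Matrix.fromBlocks_apply₂₁, Matrix.fromBlocks_apply₂₂,
      lowerToeplitz, upperToeplitz, Set.mem_Icc, Fin.val_castAdd, Fin.val_natAdd, Fin.le_def]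
    refine if_congr ?_ rfl rfl
    omega

/-- Lower triangular Toeplitz matrices commute, being multiplication of power series truncated at `X
^ 4`. A block column operation therefore clears the upper right block of the Sylvester matrix and
leaves a 4 × 4 determinant of Bézout type. The operation costs a factor `g.coeff 0 ^ 4`, whence the
hypothesis on `g`. -/
theorem Polynomial.resultant_quartic [IsDomain R] (f g : R[X]) (hg : g.coeff 0 ≠ 0) :
    resultant f g 4 4 = bezoutDet (· + ·) (· - ·) (· * ·) f.coeff g.coeff := by
  have hcomm : lowerToeplitz g * -lowerToeplitz f + lowerToeplitz f * lowerToeplitz g = 0 := by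
    ext i j
    fin_cases i <;> fin_cases j <;> simp [lowerToeplitz_eq] <;> ring
  have hmul : Matrix.fromBlocks (lowerToeplitz g) (lowerToeplitz f) (upperToeplitz g)
      (upperToeplitz f) *
      Matrix.fromBlocks 1 (-lowerToeplitz f) 0 (lowerToeplitz g) =
      Matrix.fromBlocks (lowerToeplitz g) 0 (upperToeplitz g)
        (upperToeplitz g * -lowerToeplitz f + upperToeplitz f * lowerToeplitz g) := by
    rw [Matrix.fromBlocks_multiply, hcomm]
    simp
  have hdet := congrArg Matrix.det hmul
  rw [Matrix.det_mul, Matrix.det_fromBlocks_zero₂₁, Matrix.det_fromBlocks_zero₁₂, Matrix.det_one,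
    one_mul, mul_comm] at hdet
  have hlow : (lowerToeplitz g).det ≠ 0 := by
    have : (lowerToeplitz g).det = g.coeff 0 ^ 4 := by
      rw [Matrix.det_fin_four]
      simp [lowerToeplitz_eq]
      ring
    rw [this]
    exact pow_ne_zero _ hg
  rw [resultant, ← Matrix.det_submatrix_equiv_self finSumFinEquiv,
    sylvester_submatrix_finSumFinEquiv, mul_left_cancel₀ hlow hdet]
  have hz (i j : Fin 4) :
      (upperToeplitz g * -lowerToeplitz f + upperToeplitz f * lowerToeplitz g) i j =
      ∑ k, (upperToeplitz f i k * lowerToeplitz g k j -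
        upperToeplitz g i k * lowerToeplitz f k j) := by
    rw [Matrix.add_apply, Matrix.mul_apply, Matrix.mul_apply, ← Finset.sum_add_distrib]
    refine Finset.sum_congr rfl fun k _ ↦ ?_
    rw [Matrix.neg_apply]
    ring
  rw [Matrix.det_fin_four]
  simp only [hz, Fin.sum_univ_four]
  simp only [upperToeplitz_eq, lowerToeplitz_eq, bezoutDet, Matrix.of_apply, Matrix.cons_val]
  ring

end Resultant

/-! ### Computation of the eliminant -/

namespace IntList

/-- The bivariate polynomial whose list of coefficients is given. -/
noncomputable def bivariate : List (List ℤ) → ℚ[X][X]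
  | [] => 0
  | l :: L => C (eval X l) + X * bivariate L

theorem coeff_bivariate (L : List (List ℤ)) (i : ℕ) :
    (bivariate L).coeff i = eval X (L.getD i []) := by
  induction L generalizing i with
  | nil => simp [bivariate]
  | cons l L ih => cases i <;> simp [bivariate, coeff_C_succ, ih]

theorem natDegree_bivariate {L : List (List ℤ)} {n : ℕ} (hlen : L.length = n + 1)
    (hlead : eval (X : ℚ[X]) (L.getD n []) ≠ 0) : (bivariate L).natDegree = n := by
  refine natDegree_eq_of_le_of_coeff_ne_zero (natDegree_le_iff_coeff_eq_zero.2 fun i hi ↦ ?_) ?_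
  · rw [coeff_bivariate, List.getD_eq_default _ _ (by omega), eval_nil]
  · rwa [coeff_bivariate]

theorem eval_X_ne_zero {l : List ℤ} (i : ℕ) (h : l.getD i 0 ≠ 0) : eval (X : ℚ[X]) l ≠ 0 := by
  intro h0
  have := coeff_eval_X (R := ℚ) l i
  rw [h0, coeff_zero] at this
  exact h (Int.cast_eq_zero.1 this.symm)

/-- This moves the determinant from polynomials to integer lists, where the kernel can compute it.
-/
theorem eval_bezoutDet {R : Type*} [CommRing R] (x : R) (f g : ℕ → List ℤ) :
    eval x (bezoutDet add sub mul f g) =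
      bezoutDet (· + ·) (· - ·) (· * ·) (fun i ↦ eval x (f i)) (fun i ↦ eval x (g i)) := by
  simp only [bezoutDet, eval_add, eval_sub, eval_mul]

/-- The coefficients of the resultant that eliminates `x₄`. -/
def eliminantX4 : List (List ℤ) :=
  [[859193344, 842309632, -4178123776, 173004800, 93414400], [0, 22406365184, -1033166848,
  -97499136, 4659200], [-29306683392, 890945536, -999991296, -34510848, 640000], [0, -481689600,
  24371200, 358400], [4515840000, 107520000, 640000]]

/-- The coefficients of the resultant that eliminates `x₆`. -/
def eliminantX6 : List (List ℤ) :=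
  [[1955771857936, 5001408157824, -725960927744, -36101385216, 4942652416], [9762313184000,
  -3590545226624, 20237791488, 20093186048, -760408064], [-4513841739264, -118136112384,
  20372002048, -796576768, 29246464], [-525261107200, 104385036288, 1890708480, -41187328],
  [205342019584, 3442429952, 29246464]]

/-- The squares of the abscissae cancel in `(a - a') ^ 2 + s + s'`, so each squared constraint is
only quadratic in the variable to be eliminated. -/
theorem squaredConstraint_three_four :
    squaredConstraint ((15 : ℕ) : ℚ[X][X][X]) (C (C X)) X
      (((13 : ℕ) : ℚ[X][X][X]) ^ 2 - (C (C X) - 1) ^ 2) (((5 : ℕ) : ℚ[X][X][X]) ^ 2 - X ^ 2) =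
    C (4 * (168 + 2 * C X)) * X ^ 2 + C (4 * (32 - 2 * C X) * C X) * X +
      C ((32 - 2 * C X) ^ 2 - 100 * (168 + 2 * C X - C X ^ 2)) := by
  simp only [squaredConstraint, map_add, map_sub, map_mul, map_pow, map_ofNat]
  push_cast
  ring

theorem squaredConstraint_four_five :
    squaredConstraint ((8 : ℕ) : ℚ[X][X][X]) X (C X) (((5 : ℕ) : ℚ[X][X][X]) ^ 2 - X ^ 2)
      (((5 : ℕ) : ℚ[X][X][X]) ^ 2 - C X ^ 2) =
    C 100 * X ^ 2 + C (56 * X) * X + C (100 * X ^ 2 - 2304) := by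
  simp only [squaredConstraint, map_sub, map_mul, map_pow, map_ofNat]
  push_cast
  ring

theorem squaredConstraint_five_six :
    squaredConstraint ((16 : ℕ) : ℚ[X][X][X]) (C X) X (((5 : ℕ) : ℚ[X][X][X]) ^ 2 - C X ^ 2)
      (((13 : ℕ) : ℚ[X][X][X]) ^ 2 - (X - 1) ^ 2) =
    C (104 - 8 * X) * X ^ 2 + C (126 * (2 * X - 2) - 8 * (25 - X ^ 2)) * X +
      C (3969 - 672 * (25 - X ^ 2)) := by
  simp only [squaredConstraint, map_sub, map_mul, map_pow, map_ofNat]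
  push_cast
  ring

theorem squaredConstraint_six_three :
    squaredConstraint ((10 : ℕ) : ℚ[X][X][X]) X (C (C X))
      (((13 : ℕ) : ℚ[X][X][X]) ^ 2 - (X - 1) ^ 2)
      (((13 : ℕ) : ℚ[X][X][X]) ^ 2 - (C (C X) - 1) ^ 2) =
    C 676 * X ^ 2 +
      C (2 * (236 + 2 * C X) * (2 - 2 * C X) - 8 * (168 + 2 * C X - C X ^ 2)) * X +
      C ((236 + 2 * C X) ^ 2 - 672 * (168 + 2 * C X - C X ^ 2)) := by
  simp only [squaredConstraint, map_add, map_sub, map_mul, map_pow, map_ofNat]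
  push_cast
  ring

theorem resultant_eq_of_quadratic {f g : ℚ[X][X][X]} {a₀ a₁ a₂ b₀ b₁ b₂ : ℚ[X][X]}
    (hf : f = C a₂ * X ^ 2 + C a₁ * X + C a₀) (hg : g = C b₂ * X ^ 2 + C b₁ * X + C b₀)
    (ha : a₂ ≠ 0) (hb : b₂ ≠ 0) : resultant f g =
      (a₀ * b₂ - a₂ * b₀) ^ 2 - (a₀ * b₁ - a₁ * b₀) * (a₁ * b₂ - a₂ * b₁) := by
  rw [← resultant_quadratic, ← hf, ← hg]
  -- The resultant is taken with respect to the actual degrees; these are 2 because the leading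
  -- coefficients do not vanish.
  congr 1
  · rw [hf, natDegree_quadratic ha]
  · rw [hg, natDegree_quadratic hb]

theorem resultant_three_four_five {f g : ℚ[X][X][X]}
    (hf : f = squaredConstraint ((15 : ℕ) : ℚ[X][X][X]) (C (C X)) X
      (((13 : ℕ) : ℚ[X][X][X]) ^ 2 - (C (C X) - 1) ^ 2) (((5 : ℕ) : ℚ[X][X][X]) ^ 2 - X ^ 2))
    (hg : g = squaredConstraint ((8 : ℕ) : ℚ[X][X][X]) X (C X)
      (((5 : ℕ) : ℚ[X][X][X]) ^ 2 - X ^ 2) (((5 : ℕ) : ℚ[X][X][X]) ^ 2 - C X ^ 2)) :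
    resultant f g = bivariate eliminantX4 := by
  rw [resultant_eq_of_quadratic (hf.trans squaredConstraint_three_four)
    (hg.trans squaredConstraint_four_five)]
  · simp only [bivariate, eliminantX4, map_eval]
    simp only [eval_cons, eval_nil]
    push_cast
    ring
  · intro h
    have := congrArg (Polynomial.eval 0) (congrArg (Polynomial.eval 0) h)
    norm_num at this
  · norm_num

theorem resultant_five_six_three {f g : ℚ[X][X][X]}
    (hf : f = squaredConstraint ((16 : ℕ) : ℚ[X][X][X]) (C X) X
      (((5 : ℕ) : ℚ[X][X][X]) ^ 2 - C X ^ 2) (((13 : ℕ) : ℚ[X][X][X]) ^ 2 - (X - 1) ^ 2))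
    (hg : g = squaredConstraint ((10 : ℕ) : ℚ[X][X][X]) X (C (C X))
      (((13 : ℕ) : ℚ[X][X][X]) ^ 2 - (X - 1) ^ 2)
      (((13 : ℕ) : ℚ[X][X][X]) ^ 2 - (C (C X) - 1) ^ 2)) :
    resultant f g = bivariate eliminantX6 := by
  rw [resultant_eq_of_quadratic (hf.trans squaredConstraint_five_six)
    (hg.trans squaredConstraint_six_three)]
  · simp only [bivariate, eliminantX6, map_eval]
    simp only [eval_cons, eval_nil]
    push_cast
    ring
  · intro h
    have := congrArg (Polynomial.eval 0) (congrArg (Polynomial.eval 0) h)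
    norm_num at this
  · norm_num

theorem doubletEliminant_eq :
    doubletEliminant (doubletLength ![1, 13, 15, 8, 16, 10, 13, 5, 5]) =
      eval X sexticOne * eval X sexticTwo * eval X octicOne * eval X octicTwo := by
  have hnat : (doubletLength ![1, 13, 15, 8, 16, 10, 13, 5, 5] s(1, 2) = 13 ∧
      doubletLength ![1, 13, 15, 8, 16, 10, 13, 5, 5] s(0, 3) = 5 ∧
      doubletLength ![1, 13, 15, 8, 16, 10, 13, 5, 5] s(0, 4) = 5 ∧
      doubletLength ![1, 13, 15, 8, 16, 10, 13, 5, 5] s(1, 5) = 13) ∧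
      doubletLength ![1, 13, 15, 8, 16, 10, 13, 5, 5] s(2, 3) = 15 ∧
      doubletLength ![1, 13, 15, 8, 16, 10, 13, 5, 5] s(3, 4) = 8 ∧
      doubletLength ![1, 13, 15, 8, 16, 10, 13, 5, 5] s(4, 5) = 16 ∧
      doubletLength ![1, 13, 15, 8, 16, 10, 13, 5, 5] s(5, 2) = 10 := by decide
  obtain ⟨⟨h₂, h₉, h₈, h₇⟩, h₃, h₄, h₅, h₆⟩ := hnat
  rw [doubletEliminant, h₂, h₃, h₄, h₅, h₆, h₇, h₈, h₉]
  rw [resultant_three_four_five rfl rfl, resultant_five_six_three rfl rfl,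
    natDegree_bivariate (n := 4) rfl (eval_X_ne_zero 0 (by decide)),
    natDegree_bivariate (n := 4) rfl (eval_X_ne_zero 0 (by decide)),
    resultant_quartic _ _ (by
      rw [coeff_bivariate]
      exact eval_X_ne_zero 0 (by decide))]
  have hf : (bivariate eliminantX4).coeff = fun i ↦ eval X (eliminantX4.getD i []) :=
    funext (coeff_bivariate _)
  have hg : (bivariate eliminantX6).coeff = fun i ↦ eval X (eliminantX6.getD i []) :=
    funext (coeff_bivariate _)
  -- Both sides are trimmed, since list operations may leave zeros at the end. No scalar is missing
  -- from the product: the coefficients of `sexticOne` include a common factor.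
  rw [hf, hg, ← eval_bezoutDet, ← eval_mul, ← eval_mul, ← eval_mul, ← eval_trim]
  nth_rw 2 [← eval_trim]
  refine congrArg (eval X) ?_
  decide +kernel

/-! ### A placement over each root of the second sextic -/

theorem eval_eq_zero_of_eq_mul {R : Type*} [CommRing R] {x : R} {f l : List ℤ} (q : List ℤ)
    (hx : eval x f = 0) (h : trim l = trim (mul f q)) : eval x l = 0 := by
  rw [← eval_trim, h, eval_trim, eval_mul, hx, zero_mul]

/-- The common denominator of the coordinates `y₃`, `x₄` and `y₄` as polynomials in `x₃`. -/
def coordDenom : ℤ :=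
  76592526165022026093779042382990390480000000

/-- The coordinate `y₃` times the denominator as a polynomial in `x₃`. -/
def coordY3 : List ℤ :=
  [1365379492024356906706813250693037500023320000,
  -217411516454944015197820412577659852006130000, 3121520904510215559792793126736277042000000,
  51750839963871645191612340694753613280000, -891877296663252015882967987928432640000,
  -13445088873084566483435978636206080000]

/-- The coordinate `x₄` times the denominator as a polynomial in `x₃`. -/
def coordX4 : List ℤ :=
  [-516216599770537555552225987965834409769398224, 79032395873982638872739813622589920881475036,
  -1270125726680652516367924976758258514408160, -7066111874552382694817067441900050504256,
  236562501103261824733564452734387847168, -1769520578024021777871312069058904064]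

/-- The coordinate `y₄` times the denominator as a polynomial in `x₃`. -/
def coordY4 : List ℤ :=
  [-104686911087754879200545411734909302026424268, 40932037313684006156695450974405832042887177,
  197549865470449320780476831994966240989880, -40572260222295147709538116570745866164592,
  221691261451187143569653263298426904576, 4812986560675940675250077848249700352]

theorem coordDenom_ne_zero : (coordDenom : ℂ) ≠ 0 := by
  rw [Int.cast_ne_zero]
  decide

variable {x : ℂ}

/-- Cleared of denominators, the difference of the two sides is a multiple of `sexticTwo`; the
explicit list is the quotient. The three relations that follow are certified in the same way. -/
theorem coord_three (hx : eval x sexticTwo = 0) :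
    (x - 1) ^ 2 + (eval x coordY3 / coordDenom) ^ 2 = 169 := by
  have h := eval_eq_zero_of_eq_mul
    (l := sub (add (smul (coordDenom ^ 2) (mul [-1, 1] [-1, 1])) (mul coordY3 coordY3))
      [169 * coordDenom ^ 2])
    [762600283803059623434008354282932077598746657283899845373494084100000000,
    -11700984611942088474854311736071308460433701719204384118011808800000000,
    -71350791178593365560195050515638664543601787530420103802020800000000,
    5301620536900884681146262615265586779347909789480663394713600000000,
    65796016840628365572992687272381642484092609788568489574400000000]
    hx (by decide +kernel)
  simp only [eval_sub, eval_add, eval_smul, eval_mul, eval_cons, eval_nil] at h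
  push_cast at h
  have hd := coordDenom_ne_zero
  field_simp
  linear_combination h

theorem coord_four (hx : eval x sexticTwo = 0) :
    (eval x coordX4 / coordDenom) ^ 2 + (eval x coordY4 / coordDenom) ^ 2 = 25 := by
  have h := eval_eq_zero_of_eq_mul
    (l := sub (add (mul coordX4 coordX4) (mul coordY4 coordY4)) [25 * coordDenom ^ 2])
    [113498771964115602532519369255810385525551756309745773524649867650600625,
    -1792379352977284814761563454262201366390976026836534450221309302605000,
    -32046611010076421010054459799092010624545702736068119099486595830000,
    -26588282986567584170231800308175586589307225836593917384995840000,
    9571117435382544580361165140937685660128733122615984407165440000]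
    hx (by decide +kernel)
  simp only [eval_sub, eval_add, eval_mul, eval_cons, eval_nil] at h
  push_cast at h
  have hd := coordDenom_ne_zero
  field_simp
  linear_combination h

theorem coord_three_four (hx : eval x sexticTwo = 0) :
    (x - eval x coordX4 / coordDenom) ^ 2 +
      (eval x coordY3 / coordDenom - eval x coordY4 / coordDenom) ^ 2 = 225 := by
  have h := eval_eq_zero_of_eq_mul
    (l := sub (add (mul (sub [0, coordDenom] coordX4) (sub [0, coordDenom] coordX4))
      (mul (sub coordY3 coordY4) (sub coordY3 coordY4))) [225 * coordDenom ^ 2])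
    [961280004468188312376233604101283099136553078089711911378110070624780625,
    -13811690259649285622959764622929205367435426176725264701759075435245000,
    -383862491226469041042633012398742001794976769568784970561227058870000,
    8115687979404171174162569387315079223067546821982846940611005440000,
    122473605313758787628202847019228917420284899006790805794716160000]
    hx (by decide +kernel)
  simp only [eval_sub, eval_add, eval_mul, eval_cons, eval_nil] at h
  push_cast at h
  have hd := coordDenom_ne_zero
  field_simp
  linear_combination h

/-- This is the length 16 of the edge between the two vertices obtained by rotating the other two
about the ends of the base, multiplied by 4225 = 25 · 169. -/
theorem coord_five_six (hx : eval x sexticTwo = 0) :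
    (169 * (-7 * (eval x coordX4 / coordDenom) + -24 * (eval x coordY4 / coordDenom)) -
        25 * (169 + 119 * (x - 1) + 120 * (eval x coordY3 / coordDenom))) ^ 2 +
      (169 * (24 * (eval x coordX4 / coordDenom) + -7 * (eval x coordY4 / coordDenom)) -
        25 * (-120 * (x - 1) + 119 * (eval x coordY3 / coordDenom))) ^ 2 = 256 * 4225 ^ 2 := by
  have h := eval_eq_zero_of_eq_mul
    (l :=
      let X₅₆ := sub (smul 169 (add (smul (-7) coordX4) (smul (-24) coordY4)))
        (smul 25 (add (smul coordDenom (add [169] (smul 119 [-1, 1]))) (smul 120 coordY3)))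
      let Y₅₆ := sub (smul 169 (add (smul 24 coordX4) (smul (-7) coordY4)))
        (smul 25 (add (smul (-120 * coordDenom) [-1, 1]) (smul 119 coordY3)))
      sub (add (mul X₅₆ X₅₆) (mul Y₅₆ Y₅₆)) [256 * 4225 ^ 2 * coordDenom ^ 2])
    [19409867015270969391224287552978377348707113399092346871754288474819788719140625,
    -312546869872944933879665601642566427708086211867151856504223293143650878125000,
    1977400103394565910783097767126465592239399689551361206067122107687106250000,
    67220160782075230622051642163812931845934143443729572841233493833600000000,
    458855337957366416571475282591715235199744536402757110041933582400000000]
    hx (by decide +kernel)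
  simp only [eval_sub, eval_add, eval_smul, eval_mul, eval_cons, eval_nil] at h
  push_cast at h
  have hd := coordDenom_ne_zero
  field_simp
  linear_combination h

end IntList

/-- The placement of the doublet in which the vertices `v₄` and `v₃` are at `(1 - x, y)` and
`(1 - z, w)`, and the two triangles have rational shapes. -/
noncomputable def doubletPlacement (x y z w : ℂ) : Fin 6 → ℂ × ℂ :=
  -- The reflection of the first coordinate `t ↦ 1 - t` exchanges the ends of the base and so undoes
  -- the renumbering. The apex angles of the triangles with sides 13, 13, 10 and 5, 5, 8 have
  -- cosines 119/169 and -7/25 and sines 120/169 and 24/25.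
  ![(0, 0), (1, 0), (1 - z, w), (1 - x, y),
    (-(119 * (x - 1) + 120 * y) / 169, (-120 * (x - 1) + 119 * y) / 169),
    (1 - (-7 * z + -24 * w) / 25, (24 * z + -7 * w) / 25)]

/-- The rotations build in the shapes of the triangles, so four relations account for all nine
edges. -/
theorem doubletPlacement_mem_constraintVariety {x y z w : ℂ} (h₃ : (x - 1) ^ 2 + y ^ 2 = 169)
    (h₄ : z ^ 2 + w ^ 2 = 25) (h₃₄ : (x - z) ^ 2 + (y - w) ^ 2 = 225)
    (h₅₆ : (169 * (-7 * z + -24 * w) - 25 * (169 + 119 * (x - 1) + 120 * y)) ^ 2 +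
      (169 * (24 * z + -7 * w) - 25 * (-120 * (x - 1) + 119 * y)) ^ 2 = 256 * 4225 ^ 2) :
    doubletPlacement x y z w ∈
      constraintVariety doublet 0 1 (doubletLength ![1, 5, 15, 10, 16, 8, 5, 13, 13]) := by
  let len := doubletLength ![1, 5, 15, 10, 16, 8, 5, 13, 13]
  -- Stated for unordered pairs, the condition has to be checked only once for each edge.
  let P (e : Sym2 (Fin 6)) : Prop := ∀ v w', s(v, w') = e →
    ((doubletPlacement x y z w v).1 - (doubletPlacement x y z w w').1) ^ 2 +
      ((doubletPlacement x y z w v).2 - (doubletPlacement x y z w w').2) ^ 2 =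
        (len s(v, w') : ℂ) ^ 2
  have hP (a b : Fin 6) (n : ℕ) (hn : len s(a, b) = n)
      (h : ((doubletPlacement x y z w a).1 - (doubletPlacement x y z w b).1) ^ 2 +
        ((doubletPlacement x y z w a).2 - (doubletPlacement x y z w b).2) ^ 2 = (n : ℂ) ^ 2) :
      P s(a, b) := by
    intro v w' hvw
    rw [hvw, hn, ← h]
    rcases Sym2.eq_iff.1 hvw with ⟨rfl, rfl⟩ | ⟨rfl, rfl⟩
    · rfl
    · ring
  refine ⟨rfl, rfl, fun v w' hvw ↦ ?_⟩
  rw [doublet, SimpleGraph.fromEdgeSet_adj] at hvw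
  suffices h : ∀ e ∈ ({s(0, 1), s(1, 2), s(2, 3), s(3, 4), s(4, 5), s(5, 2), s(1, 5), s(0, 4),
      s(0, 3)} : Set (Sym2 (Fin 6))), P e from h _ hvw.1 v w' rfl
  simp only [Set.mem_insert_iff, Set.mem_singleton_iff, forall_eq_or_imp, forall_eq]
  refine ⟨hP _ _ 1 (by decide) ?_, hP _ _ 5 (by decide) ?_, hP _ _ 15 (by decide) ?_,
    hP _ _ 10 (by decide) ?_, hP _ _ 16 (by decide) ?_, hP _ _ 8 (by decide) ?_,
    hP _ _ 5 (by decide) ?_, hP _ _ 13 (by decide) ?_, hP _ _ 13 (by decide) ?_⟩ <;>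
  simp only [doubletPlacement, Matrix.cons_val] <;> push_cast
  · ring
  · linear_combination h₄
  · linear_combination h₃₄
  · linear_combination (100 / 169) * h₃
  · linear_combination h₅₆ / 4225 ^ 2
  · linear_combination (64 / 25) * h₄
  · linear_combination h₄
  · linear_combination h₃
  · linear_combination h₃

/-! ### Insolubility by radicals -/

theorem HasFullSymmetricGaloisGroup.not_isSolvable {p : ℚ[X]} (hp : Irreducible p)
    (hdeg : 5 ≤ p.natDegree) (h : HasFullSymmetricGaloisGroup p) : ¬ Group.IsSolvable p.Gal := by
  intro hsol
  have : Fact ((p.map (algebraMap ℚ ℂ)).Splits) := ⟨IsAlgClosed.splits _⟩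
  refine Equiv.Perm.not_isSolvable (p.rootSet ℂ) ?_ (Group.isSolvable_of_surjective h.2)
  have hcard := card_rootSet_eq_natDegree hp.separable (this.out)
  rw [Cardinal.mk_fintype, hcard]
  exact_mod_cast hdeg

theorem not_isSolubleByRadicals_doublet :
    ¬ IsSolubleByRadicals doublet 0 1 (doubletLength ![1, 5, 15, 10, 16, 8, 5, 13, 13]) := by
  intro hsol
  obtain ⟨hirr, hgal⟩ := IntList.irreducible_and_hasFullSymmetricGaloisGroup_sexticTwo
  obtain ⟨x, hx⟩ := IsAlgClosed.exists_aeval_eq_zero ℂ _ (degree_pos_of_irreducible hirr).ne'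
  have hx' : IntList.eval x IntList.sexticTwo = 0 := by
    rwa [← AlgHom.coe_toRingHom, IntList.map_eval, AlgHom.coe_toRingHom, aeval_X] at hx
  -- Vertex `3` is `v₄`, whose first coordinate in the placement is `1 - x`; hence `x` itself would
  -- be a radical expression.
  have hmem := (hsol _ (doubletPlacement_mem_constraintVariety (IntList.coord_three hx')
    (IntList.coord_four hx') (IntList.coord_three_four hx') (IntList.coord_five_six hx')) 3).1
  have hxrad : x ∈ solvableByRad ℚ ℂ := by
    have := sub_mem (one_mem (solvableByRad ℚ ℂ)) hmem
    simpa [doubletPlacement] using this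
  refine hgal.not_isSolvable hirr ?_ (isSolvable_gal_of_irreducible hxrad hirr hx)
  rw [IntList.natDegree_eval_X (n := 6) rfl (by decide)]
  norm_num

theorem theorem8p2 :
    ¬ IsSolubleByRadicals doublet 0 1 (doubletLength ![1, 5, 15, 10, 16, 8, 5, 13, 13]) ∧
    (doubletEliminant (doubletLength ![1, 13, 15, 8, 16, 10, 13, 5, 5])).natDegree = 28 ∧
    ∃ p₁ p₂ p₃ p₄ : Polynomial ℚ,
      doubletEliminant (doubletLength ![1, 13, 15, 8, 16, 10, 13, 5, 5]) = p₁ * p₂ * p₃ * p₄ ∧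
      p₁.natDegree = 6 ∧ p₂.natDegree = 6 ∧ p₃.natDegree = 8 ∧ p₄.natDegree = 8 ∧
      ∀ p ∈ [p₁, p₂, p₃, p₄], Irreducible p ∧ HasFullSymmetricGaloisGroup p := by
  have h₁ : (IntList.eval (X : ℚ[X]) IntList.sexticOne).natDegree = 6 :=
    IntList.natDegree_eval_X rfl (by decide)
  have h₂ : (IntList.eval (X : ℚ[X]) IntList.sexticTwo).natDegree = 6 :=
    IntList.natDegree_eval_X rfl (by decide)
  have h₃ : (IntList.eval (X : ℚ[X]) IntList.octicOne).natDegree = 8 :=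
    IntList.natDegree_eval_X rfl (by decide)
  have h₄ : (IntList.eval (X : ℚ[X]) IntList.octicTwo).natDegree = 8 :=
    IntList.natDegree_eval_X rfl (by decide)
  have g₁ := IntList.irreducible_and_hasFullSymmetricGaloisGroup_sexticOne
  have g₂ := IntList.irreducible_and_hasFullSymmetricGaloisGroup_sexticTwo
  have g₃ := IntList.irreducible_and_hasFullSymmetricGaloisGroup_octicOne
  have g₄ := IntList.irreducible_and_hasFullSymmetricGaloisGroup_octicTwo
  refine ⟨not_isSolubleByRadicals_doublet, ?_, _, _, _, _, IntList.doubletEliminant_eq, h₁, h₂, h₃,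
    h₄, by simpa using ⟨g₁, g₂, g₃, g₄⟩⟩
  have n₁ := g₁.1.ne_zero
  have n₂ := g₂.1.ne_zero
  have n₃ := g₃.1.ne_zero
  have n₄ := g₄.1.ne_zero
  rw [IntList.doubletEliminant_eq, natDegree_mul (mul_ne_zero (mul_ne_zero n₁ n₂) n₃) n₄,
    natDegree_mul (mul_ne_zero n₁ n₂) n₃, natDegree_mul n₁ n₂, h₁, h₂, h₃, h₄]
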